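/- All graphs are finite and simple and have at least one edge. For such a graph $G$ with vertex set $V(G)$ and edge set $E(G)$, and a field $K$, let $S_G=K[s_e,t_e : e\in E(G)]$ be the standard graded polynomial ring in $2|E(G)|$ variables. For $A\subseteq V(G)$ let $u_A=\prod_{e\in E(G)}\alpha_e$, where $\alpha_e=s_e$ if one vertex of $e$ lies in $A$ and the other lies in $V(G)\setminus A$, and $\alpha_e=t_e$ otherwise. The monomial cut ideal of $G$ is $I(G)=\langle u_A : A\subseteq V(G)\rangle\subseteq S_G$. For a nonzero homogeneous ideal $I$ of a standard graded polynomial ring $P$ over $K$ let $\beta_{i,j}(I)=\dim_K \operatorname{Tor}_i^P(I,K)_j$, and let $$\operatorname{projdim} I=\max\{i : \beta_{i,j}(I)\neq 0\text{ for some } j\},\qquad \operatorname{reg} I=\max\{j : \beta_{i,i+j}(I)\neq 0\text{ for some } i\}.$$ Let $G_1,\dots,G_r$ be graphs such that $$|(V(G_1)\cup\dots\cup V(G_{i-1}))\cap V(G_i)|\le 1\quad\text{for all } i=2,\dots,r,$$ and let $G=G_1\cup\dots\cup G_r$ be the graph with vertex set $\bigcup_k V(G_k)$ and edge set $\bigcup_k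 E(G_k)$. Then $$\operatorname{projdim} I(G)=\sum_{k=1}^r \operatorname{projdim} I(G_k)\qquad\text{and}\qquad \operatorname{reg} I(G)=\sum_{k=1}^r \operatorname{reg} I(G_k).$$ -/

import Mathlib

namespace CutIdeals

open MvPolynomial

/-! ### Graded Betti numbers of homogeneous ideals

`P = K[x_a : a ∈ σ]` is the standard graded polynomial ring in finitely many variables over a
field `K`. The graded Betti number `β_{i,j}(I) = dim_K Tor_i^P(I, K)_j` is defined by tensoring `I`
with the Koszul complex on the variables, which is the minimal graded free resolution of
`K = P / (x_a : a ∈ σ)`. -/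

section Betti

variable {σ K : Type*} [Fintype σ] [Field K]

/-- The degree `j` component of the shifted ideal `I(-i)`, that is, the `K`-vector space `I_{j-i}`
of the elements of `I` which are homogeneous of degree `j - i` (it is zero when `j < i`). -/
def shiftedComponent (I : Ideal (MvPolynomial σ K)) (i j : ℕ) :
    Submodule K (MvPolynomial σ K) where
  carrier := {f | f ∈ I ∧ ∀ m ∈ f.support, m.degree + i = j}
  zero_mem' := ⟨I.zero_mem, by simp⟩
  add_mem' := by
    classical
    rintro f g ⟨hf, hf'⟩ ⟨hg, hg'⟩
    refine ⟨I.add_mem hf hg, fun m hm => ?_⟩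
    rcases Finset.mem_union.1 (MvPolynomial.support_add hm) with h | h
    · exact hf' m h
    · exact hg' m h
  smul_mem' := by
    rintro c f ⟨hf, hf'⟩
    refine ⟨?_, fun m hm => hf' m (MvPolynomial.support_smul hm)⟩
    rw [MvPolynomial.smul_eq_C_mul]
    exact I.mul_mem_left _ hf

/-- The degree `j` part of `I ⊗ ⋀^i P(-1)^σ`. A chain `c` stands for the element in which
`e_{a_1} ∧ ⋯ ∧ e_{a_i}` has the coefficient `c (a_1, …, a_i) ∈ I_{j-i}`; so `c` is alternating in
its indices. -/
def koszulChains (I : Ideal (MvPolynomial σ K)) (i j : ℕ) :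
    Submodule K ((Fin i → σ) → MvPolynomial σ K) where
  carrier := {c | (∀ v, c v ∈ shiftedComponent I i j) ∧
    (∀ v, ¬ Function.Injective v → c v = 0) ∧
    ∀ (π : Equiv.Perm (Fin i)) (v : Fin i → σ), c (v ∘ π) = (Equiv.Perm.sign π : ℤ) • c v}
  zero_mem' := ⟨fun _ => Submodule.zero_mem _, by simp, by simp⟩
  add_mem' := by
    rintro c d ⟨h1, h2, h3⟩ ⟨k1, k2, k3⟩
    exact ⟨fun v => Submodule.add_mem _ (h1 v) (k1 v), fun v hv => by simp [h2 v hv, k2 v hv],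
      fun π v => by simp only [Pi.add_apply, h3, k3, smul_add]⟩
  smul_mem' := by
    rintro a c ⟨h1, h2, h3⟩
    exact ⟨fun v => Submodule.smul_mem _ a (h1 v), fun v hv => by simp [h2 v hv],
      fun π v => by simp only [Pi.smul_apply, h3]; rw [smul_comm]⟩

/-- The Koszul differential, contraction with `∑ a, x_a e_a^*`:
`(∂c) (a_1, …, a_i) = ∑ a, x_a c (a, a_1, …, a_i)`. -/
noncomputable def koszulD (σ K : Type*) [Fintype σ] [Field K] (i : ℕ) :
    ((Fin (i + 1) → σ) → MvPolynomial σ K) →ₗ[K] ((Fin i → σ) → MvPolynomial σ K) where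
  toFun c v := ∑ a : σ, X a * c (Fin.cons a v)
  map_add' c d := by
    ext1 v
    simp [mul_add, Finset.sum_add_distrib]
  map_smul' r c := by
    ext1 v
    simp [Finset.smul_sum]

/-- The `i`-cycles of degree `j` of `I ⊗ Koszul` (in homological degree `0` every chain is one). -/
noncomputable def koszulCycles (I : Ideal (MvPolynomial σ K)) :
    (i j : ℕ) → Submodule K ((Fin i → σ) → MvPolynomial σ K)
  | 0, j => koszulChains I 0 j
  | i + 1, j => koszulChains I (i + 1) j ⊓ LinearMap.ker (koszulD σ K i)

/-- The `i`-boundaries of degree `j` of `I ⊗ Koszul`. -/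
noncomputable def koszulBoundaries (I : Ideal (MvPolynomial σ K)) (i j : ℕ) :
    Submodule K ((Fin i → σ) → MvPolynomial σ K) :=
  (koszulChains I (i + 1) j).map (koszulD σ K i)

/-- The differential maps chains of degree `j` to chains of degree `j`. -/
theorem koszulD_mem_koszulChains (I : Ideal (MvPolynomial σ K)) (i j : ℕ)
    {c : (Fin (i + 1) → σ) → MvPolynomial σ K} (hc : c ∈ koszulChains I (i + 1) j) :
    koszulD σ K i c ∈ koszulChains I i j := by
  obtain ⟨h1, h2, h3⟩ := hc
  refine ⟨fun v => Submodule.sum_mem _ fun a _ => ?_, fun v hv => ?_, fun π v => ?_⟩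
  · obtain ⟨k1, k2⟩ := h1 (Fin.cons a v)
    refine ⟨I.mul_mem_left _ k1, fun m hm => ?_⟩
    rw [MvPolynomial.support_X_mul] at hm
    obtain ⟨m', hm', rfl⟩ := Finset.mem_map.1 hm
    have := k2 m' hm'
    simp only [addLeftEmbedding_apply, map_add, Finsupp.degree_single]
    omega
  · refine Finset.sum_eq_zero fun a _ => ?_
    rw [h2 _ fun h => hv (Fin.cons_injective_iff.1 h).2, mul_zero]
  · change ∑ a : σ, X a * c (Fin.cons a (v ∘ π)) = _ • ∑ a : σ, X a * c (Fin.cons a v)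
    rw [Finset.smul_sum]
    refine Finset.sum_congr rfl fun a _ => ?_
    have h := h3 (Equiv.Perm.decomposeFin.symm (0, π)) (Fin.cons a v)
    have hv : (Fin.cons a v : Fin (i + 1) → σ) ∘ Equiv.Perm.decomposeFin.symm (0, π) =
        Fin.cons a (v ∘ π) := by
      funext k
      refine Fin.cases ?_ (fun k => ?_) k <;> simp
    rw [hv] at h
    simp only [Equiv.Perm.decomposeFin.symm_sign, if_true, one_mul] at h
    rw [h, mul_smul_comm]

/-- The Koszul differential squares to zero. -/
theorem koszulD_koszulD (I : Ideal (MvPolynomial σ K)) (i j : ℕ)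
    {c : (Fin (i + 2) → σ) → MvPolynomial σ K} (hc : c ∈ koszulChains I (i + 2) j) :
    koszulD σ K i (koszulD σ K (i + 1) c) = 0 := by
  obtain ⟨-, h2, h3⟩ := hc
  ext1 v
  change ∑ a : σ, X a * ∑ b : σ, X b * c (Fin.cons b (Fin.cons a v)) = 0
  simp only [Finset.mul_sum]
  rw [← Fintype.sum_prod_type' (f := fun a b : σ => (X a : MvPolynomial σ K) *
    (X b * c (Fin.cons b (Fin.cons a v))))]
  have key : ∀ a b : σ, c (Fin.cons b (Fin.cons a v)) = - c (Fin.cons a (Fin.cons b v)) := by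
    intro a b
    have h := h3 (Equiv.swap 0 1) (Fin.cons a (Fin.cons b v))
    have hv : (Fin.cons a (Fin.cons b v) : Fin (i + 2) → σ) ∘ Equiv.swap 0 1 =
        Fin.cons b (Fin.cons a v) := by
      funext k
      refine Fin.cases ?_ (fun k => Fin.cases ?_ (fun k => ?_) k) k
      · rw [Function.comp_apply, Equiv.swap_apply_left]
        rfl
      · rw [Function.comp_apply, Fin.succ_zero_eq_one, Equiv.swap_apply_right]
        rfl
      · have k0 : (k.succ.succ : Fin (i + 2)) ≠ 0 := Fin.succ_ne_zero _
        have k1 : (k.succ.succ : Fin (i + 2)) ≠ 1 := by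
          rw [← Fin.succ_zero_eq_one]
          exact fun h => Fin.succ_ne_zero k (Fin.succ_injective _ h)
        simp [Equiv.swap_apply_of_ne_of_ne k0 k1]
    rw [hv] at h
    simpa [Equiv.Perm.sign_swap] using h
  refine Finset.sum_involution (fun p _ => p.swap) ?_ ?_ (by simp) (by simp)
  · rintro ⟨a, b⟩ -
    simp only [Prod.swap]
    rw [key a b]
    ring
  · rintro ⟨a, b⟩ - hne heq
    simp only [Prod.swap, Prod.mk.injEq] at heq
    obtain ⟨rfl, -⟩ := heq
    refine hne ?_
    rw [h2 _ fun h => ?_, mul_zero, mul_zero]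
    exact absurd (@h 0 1 rfl) (by simp)

theorem koszulBoundaries_le_koszulCycles (I : Ideal (MvPolynomial σ K)) (i j : ℕ) :
    koszulBoundaries I i j ≤ koszulCycles I i j := by
  rintro _ ⟨c, hc, rfl⟩
  cases i with
  | zero => exact koszulD_mem_koszulChains I 0 j hc
  | succ i => exact ⟨koszulD_mem_koszulChains I (i + 1) j hc, koszulD_koszulD I i j hc⟩

/-- `Tor_i(I, K)_j`, the degree `j` part of the `i`-th homology of `I ⊗ Koszul`. -/
abbrev GradedTor (I : Ideal (MvPolynomial σ K)) (i j : ℕ) : Type _ :=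
  koszulCycles I i j ⧸ (koszulBoundaries I i j).submoduleOf (koszulCycles I i j)

/-- The graded Betti number `β_{i,j}(I) = dim_K Tor_i(I, K)_j`. -/
noncomputable def gradedBetti (I : Ideal (MvPolynomial σ K)) (i j : ℕ) : ℕ :=
  Module.finrank K (GradedTor I i j)

/-- `p` is the projective dimension of `I`, the maximum of the `i` with `β_{i,j}(I) ≠ 0` for
some `j`. -/
def IsProjDim (I : Ideal (MvPolynomial σ K)) (p : ℕ) : Prop :=
  IsGreatest {i | ∃ j, gradedBetti I i j ≠ 0} p

/-- `q` is the Castelnuovo–Mumford regularity of `I`, the maximum of the `j` with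
`β_{i,i+j}(I) ≠ 0` for some `i`. -/
def IsRegularity (I : Ideal (MvPolynomial σ K)) (q : ℕ) : Prop :=
  IsGreatest {j | ∃ i, gradedBetti I i (i + j) ≠ 0} q

end Betti

/-! ### Monomial cut ideals -/

section Cut

/-- A simple graph whose vertices form a subset of `V`. The union of such graphs (union of the
vertex sets and union of the edge sets) is their supremum. -/
abbrev Graph (V : Type*) := (⊤ : SimpleGraph V).Subgraph

variable {V : Type*} [Finite V]

noncomputable instance edgeFintype (G : Graph V) : Fintype G.edgeSet := Fintype.ofFinite _

/-- The edge `e` has one vertex in `A` and the other one in `V(G) \ A`. -/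
def IsCutBy (G : Graph V) (A : Set V) (e : Sym2 V) : Prop :=
  (∃ v ∈ e, v ∈ A) ∧ ∃ w ∈ e, w ∈ G.verts \ A

/-- The variables of the polynomial ring of `G`: `Sum.inl e` is `s_e` and `Sum.inr e` is `t_e`. -/
abbrev CutVar (G : Graph V) := G.edgeSet ⊕ G.edgeSet

open Classical in
/-- The cut monomial `u_A`: the product over all edges `e` of `G` of `s_e` if `e` is cut by `A` and
of `t_e` otherwise. -/
noncomputable def cutMonomial (K : Type*) [Field K] (G : Graph V) (A : Set V) :
    MvPolynomial (CutVar G) K :=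
  ∏ e : G.edgeSet, if IsCutBy G A e then X (Sum.inl e) else X (Sum.inr e)

/-- The monomial cut ideal `I(G)`, generated by the `u_A` with `A ⊆ V(G)`. -/
noncomputable def cutIdeal (K : Type*) [Field K] (G : Graph V) :
    Ideal (MvPolynomial (CutVar G) K) :=
  Ideal.span {u | ∃ A : Set V, A ⊆ G.verts ∧ u = cutMonomial K G A}

end Cut

end CutIdeals

/-! A cut monomial does not change when `A` is replaced by its complement. If two graphs share at
most one vertex, a cut of one and a cut of the other can therefore be made to agree there and be
glued to a cut of the union. The graphs have no common edge, so the ideal of the union is the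
product of the two ideals in disjoint sets of variables (`isExponentProd_cutExponents`). Induction
on the number of graphs reduces everything to such products.

For a monomial ideal, the part of the Koszul complex in multidegree `α` is the chain complex of a
simplicial complex, the upper Koszul complex (`gradedBetti_monomialIdeal_ne_zero_iff`). For a
product in disjoint variables, a face is a pair of faces and the chain complex is a tensor product.
The Künneth formula over a field (`hasHomology_prod_iff`) then says that a Betti number of the
product is nonzero exactly when its index is a sum of indices of nonzero Betti numbers of the
factors. Maxima of sums are sums of maxima, both for `i` and for `j - i`.

The maxima exist because nonzero Betti numbers occur only for `i` up to the number of variables and,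
the generators being squarefree, only in squarefree multidegrees (`not_hasHomology_of_one_lt`). -/

namespace CutIdeals

/-! ### Künneth formula for finite complexes of vector spaces -/

section MatrixComplex

open Matrix

variable {K X Y Z : Type*} [Field K] [Fintype X] [Fintype Y] [Fintype Z]

/-- The complex with basis `X`, graded by `deg`, and with differential `A` has nonzero homology
in degree `i`. -/
def HasHomology (A : Matrix X X K) (deg : X → ℕ) (i : ℕ) : Prop :=
  ∃ f : X → K, (∀ x, f x ≠ 0 → deg x = i) ∧ A *ᵥ f = 0 ∧ ∀ g, A *ᵥ g ≠ f

/-- The matrix `A` is a differential which lowers the degree by one. -/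
structure IsDifferential (A : Matrix X X K) (deg : X → ℕ) : Prop where
  degree_eq : ∀ x y, A x y ≠ 0 → deg y = deg x + 1
  mul_self : A * A = 0

/-- Over a field, a section of `A` onto its range extends to the whole space. -/
theorem exists_mul_mul_eq_self [DecidableEq X] (A : Matrix X X K) :
    ∃ M : Matrix X X K, A * M * A = A := by
  obtain ⟨g, hg⟩ := (toLin' A).rangeRestrict.exists_rightInverse_of_surjective
    (LinearMap.range_rangeRestrict _)
  obtain ⟨h, hh⟩ := LinearMap.exists_extend g
  refine ⟨LinearMap.toMatrix' h, ?_⟩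
  apply toLin'.injective
  rw [toLin'_mul, toLin'_mul, toLin'_toMatrix']
  refine LinearMap.ext fun v => ?_
  simp only [LinearMap.comp_apply]
  have h1 := LinearMap.congr_fun hh ⟨toLin' A v, LinearMap.mem_range_self _ _⟩
  have h2 := LinearMap.congr_fun hg ⟨toLin' A v, LinearMap.mem_range_self _ _⟩
  simp only [LinearMap.comp_apply, Submodule.subtype_apply, LinearMap.id_apply] at h1 h2
  rw [h1]
  exact congrArg Subtype.val h2

/-- Only the entries of `M` that raise the degree by one matter for the entries of `A * M * A` where
`A` can be nonzero; the others may be deleted. -/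
theorem exists_graded_mul_mul_eq_self {A : Matrix X X K} {deg : X → ℕ}
    (hA : IsDifferential A deg) :
    ∃ M : Matrix X X K, A * M * A = A ∧ ∀ x y, M x y ≠ 0 → deg x = deg y + 1 := by
  classical
  obtain ⟨M, hM⟩ := exists_mul_mul_eq_self A
  refine ⟨of fun x y => if deg x = deg y + 1 then M x y else 0, ?_, fun x y h => ?_⟩
  · ext x y
    by_cases hxy : deg y = deg x + 1
    · conv_rhs => rw [← hM]
      simp only [mul_apply, Finset.sum_mul, of_apply]
      refine Finset.sum_congr rfl fun v _ => Finset.sum_congr rfl fun u _ => ?_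
      by_cases h1 : A x u = 0
      · simp [h1]
      by_cases h2 : A v y = 0
      · simp [h2]
      have h1 := hA.degree_eq _ _ h1
      have h2 := hA.degree_eq _ _ h2
      rw [if_pos (by omega)]
    · have h0 : A x y = 0 := by
        by_contra h
        exact hxy (hA.degree_eq _ _ h)
      rw [h0]
      simp only [mul_apply, Finset.sum_mul, of_apply]
      refine Finset.sum_eq_zero fun v _ => Finset.sum_eq_zero fun u _ => ?_
      by_cases h1 : A x u = 0
      · simp [h1]
      by_cases h2 : A v y = 0
      · simp [h2]
      have h1 := hA.degree_eq _ _ h1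
      have h2 := hA.degree_eq _ _ h2
      rw [if_neg (by omega)]
      simp
  · by_contra h'
    exact h (by rw [of_apply, if_neg h'])

/-- A vector outside the range of `A` is detected by a linear functional vanishing on that range. -/
theorem exists_vecMul_eq_zero {A : Matrix X X K} {z : X → K} (hz : ∀ g, A *ᵥ g ≠ z) :
    ∃ p : X → K, p ᵥ* A = 0 ∧ p ⬝ᵥ z ≠ 0 := by
  classical
  obtain ⟨f, hf, hle⟩ := Submodule.exists_le_ker_of_notMem (p := LinearMap.range A.mulVecLin)
    (v := z) (by rintro ⟨g, hg⟩; exact hz g hg)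
  have key : ∀ v, (fun x => f (Pi.single x 1)) ⬝ᵥ v = f v := by
    intro v
    conv_rhs => rw [pi_eq_sum_univ' v, map_sum]
    refine Finset.sum_congr rfl fun x _ => ?_
    rw [map_smul, smul_eq_mul, mul_comm]
  refine ⟨fun x => f (Pi.single x 1), ?_, by rwa [key]⟩
  apply dotProduct_eq
  intro v
  rw [← dotProduct_mulVec, key, zero_dotProduct]
  exact hle ⟨v, rfl⟩

/-- The projection `1 - AM - MA` associated with a homotopy `M` squares to zero in the degrees
without homology. -/
theorem sq_apply_eq_zero [DecidableEq X] {A M : Matrix X X K} {deg : X → ℕ}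
    (hA : IsDifferential A deg) (hM : A * M * A = A)
    (hdeg : ∀ x y, M x y ≠ 0 → deg x = deg y + 1) {i : ℕ} (hi : ¬ HasHomology A deg i) {x y : X}
    (hy : deg y = i) : ((1 - A * M - M * A) * (1 - A * M - M * A)) x y = 0 := by
  set P := 1 - A * M - M * A
  have hAP : A * P = 0 := by
    have h0 := hA.mul_self
    have : A * P = A - A * A * M - A * M * A := by simp only [P]; noncomm_ring
    rw [this, h0, hM]
    simp
  have hPA : P * A = 0 := by
    have h0 := hA.mul_self
    have : P * A = A - A * M * A - M * (A * A) := by simp only [P]; noncomm_ring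
    rw [this, h0, hM]
    simp
  have hdP : ∀ x, P x y ≠ 0 → deg x = i := by
    intro x hx
    by_contra hne
    refine hx ?_
    have h1 : (A * M) x y = 0 := by
      refine Finset.sum_eq_zero fun u _ => ?_
      by_contra h
      have h1 := hA.degree_eq _ _ (left_ne_zero_of_mul h)
      have h2 := hdeg _ _ (right_ne_zero_of_mul h)
      omega
    have h2 : (M * A) x y = 0 := by
      refine Finset.sum_eq_zero fun u _ => ?_
      by_contra h
      have h1 := hA.degree_eq _ _ (right_ne_zero_of_mul h)
      have h2 := hdeg _ _ (left_ne_zero_of_mul h)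
      omega
    have h3 : (1 : Matrix X X K) x y = 0 := one_apply_ne (by rintro rfl; exact hne hy)
    simp only [P, Matrix.sub_apply, h1, h2, h3, sub_zero]
  -- The columns of `P` are cycles because `A * P = 0`. Without homology they are boundaries, and
  -- `P` kills boundaries because `P * A = 0`.
  have hz : A *ᵥ (fun x => P x y) = 0 := by
    ext u
    exact congrFun (congrFun hAP u) y
  have hb : ∃ g, A *ᵥ g = fun x => P x y := by
    by_contra! h
    exact hi ⟨_, hdP, hz, h⟩
  obtain ⟨g, hg⟩ := hb
  have h1 : P *ᵥ (fun x => P x y) = 0 := by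
    rw [← hg, mulVec_mulVec, hPA, zero_mulVec]
  exact congrFun h1 x

theorem diagonal_mul_eq_neg [DecidableEq X] {M : Matrix X X K} {deg : X → ℕ}
    (h : ∀ x y, M x y ≠ 0 → deg x = deg y + 1 ∨ deg y = deg x + 1) :
    diagonal (fun x => (-1 : K) ^ deg x) * M = - (M * diagonal (fun x => (-1 : K) ^ deg x)) := by
  ext x y
  rw [neg_apply, diagonal_mul, mul_diagonal]
  by_cases h0 : M x y = 0
  · simp [h0]
  · rcases h x y h0 with h | h <;> rw [h, pow_succ] <;> ring

theorem diagonal_mul_diagonal_neg_one_pow [DecidableEq X] (deg : X → ℕ) :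
    diagonal (fun x => (-1 : K) ^ deg x) * diagonal (fun x => (-1 : K) ^ deg x) = 1 := by
  rw [diagonal_mul_diagonal, ← diagonal_one]
  congr 1
  ext x
  rw [← mul_pow]
  simp

/-- A matrix `F` is a chain of the tensor product, with differential `F ↦ A F + E F Bᵀ`, where the
sign matrix `E` anticommutes with maps that shift the degree by one. Since `P` and `Q` are homotopic
to the identity, a cycle `F` is homologous to `P² F (Q²)ᵀ`. This vanishes if in each bidegree met by
`F` one factor has no homology. -/
theorem exists_of_hasHomology_mul [DecidableEq X] [DecidableEq Y] {A : Matrix X X K}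
    {B : Matrix Y Y K} {dX : X → ℕ} {dY : Y → ℕ} (hA : IsDifferential A dX)
    (hB : IsDifferential B dY) {n : ℕ} {F : Matrix X Y K}
    (hF : ∀ x y, F x y ≠ 0 → dX x + dY y = n)
    (hcyc : A * F + diagonal (fun x => (-1 : K) ^ dX x) * F * Bᵀ = 0)
    (hbd : ∀ H : Matrix X Y K,
      A * H + diagonal (fun x => (-1 : K) ^ dX x) * H * Bᵀ ≠ F) :
    ∃ i j, i + j = n ∧ HasHomology A dX i ∧ HasHomology B dY j := by
  by_contra! hno
  obtain ⟨M, hM, hMd⟩ := exists_graded_mul_mul_eq_self hA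
  obtain ⟨N, hN, hNd⟩ := exists_graded_mul_mul_eq_self hB
  set E : Matrix X X K := diagonal (fun x => (-1 : K) ^ dX x)
  have hEA : E * A = -(A * E) := diagonal_mul_eq_neg fun x y h => Or.inr (hA.degree_eq x y h)
  have hEM : E * M = -(M * E) := diagonal_mul_eq_neg fun x y h => Or.inl (hMd x y h)
  have hEE : E * E = 1 := diagonal_mul_diagonal_neg_one_pow dX
  set P := 1 - A * M - M * A with hP
  set Q := 1 - B * N - N * B with hQ
  have stepP : ∀ F : Matrix X Y K, A * F + E * F * Bᵀ = 0 →
      A * (P * F) + E * (P * F) * Bᵀ = 0 ∧ ∃ H : Matrix X Y K, A * H + E * H * Bᵀ = F - P * F := by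
    intro F hF
    -- The homotopy `M` acts on the first factor; anticommuting `E` past `M` turns the second term
    -- into `M * A * F`, as `F` is a cycle.
    have h1 : A * (M * F) + E * (M * F) * Bᵀ = F - P * F := by
      have e1 : E * (M * F) * Bᵀ = -(M * (E * F * Bᵀ)) := by
        calc E * (M * F) * Bᵀ = (E * M) * F * Bᵀ := by simp only [Matrix.mul_assoc]
          _ = _ := by rw [hEM]; simp only [Matrix.mul_assoc, Matrix.neg_mul]
      have e2 : E * F * Bᵀ = -(A * F) := eq_neg_of_add_eq_zero_right hF
      rw [e1, e2, hP]
      simp only [Matrix.sub_mul, Matrix.one_mul, Matrix.mul_neg, neg_neg, Matrix.mul_assoc]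
      abel
    refine ⟨?_, M * F, h1⟩
    have hPF : P * F = F - (A * (M * F) + E * (M * F) * Bᵀ) := by rw [h1]; abel
    have h2 : A * (A * (M * F) + E * (M * F) * Bᵀ) +
        E * (A * (M * F) + E * (M * F) * Bᵀ) * Bᵀ = 0 := by
      have hBB : Bᵀ * Bᵀ = 0 := by rw [← transpose_mul, hB.mul_self, transpose_zero]
      generalize M * F = G
      have e1 : A * (A * G) = 0 := by rw [← Matrix.mul_assoc, hA.mul_self, Matrix.zero_mul]
      have e2 : E * (E * G * Bᵀ) * Bᵀ = 0 := by
        simp only [Matrix.mul_assoc, hBB, Matrix.mul_zero]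
      have e3 : E * (A * G) * Bᵀ = - (A * (E * G * Bᵀ)) := by
        rw [← Matrix.mul_assoc E A G, hEA]
        simp only [Matrix.mul_assoc, Matrix.neg_mul]
      rw [Matrix.mul_add, Matrix.mul_add, Matrix.add_mul, e1, e2, e3]
      abel
    rw [hPF, Matrix.mul_sub, Matrix.mul_sub, Matrix.sub_mul]
    rw [show ∀ a b c d : Matrix X Y K, a - b + (c - d) = (a + c) - (b + d) by intros; abel, hF, h2,
      sub_zero]
  have stepQ : ∀ F : Matrix X Y K, A * F + E * F * Bᵀ = 0 →
      A * (F * Qᵀ) + E * (F * Qᵀ) * Bᵀ = 0 ∧ ∃ H : Matrix X Y K, A * H + E * H * Bᵀ = F - F * Qᵀ := by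
    intro F hF
    -- The homotopy on the second factor carries the sign `E`, which cancels the one in the
    -- differential.
    have h1 : A * (E * F * Nᵀ) + E * (E * F * Nᵀ) * Bᵀ = F - F * Qᵀ := by
      have e1 : A * (E * F * Nᵀ) = -(E * (A * F) * Nᵀ) := by
        calc A * (E * F * Nᵀ) = -((-(A * E)) * F * Nᵀ) := by
              simp only [Matrix.mul_assoc, Matrix.neg_mul, neg_neg]
          _ = _ := by rw [← hEA]; simp only [Matrix.mul_assoc]
      have e2 : A * F = -(E * F * Bᵀ) := eq_neg_of_add_eq_zero_left hF
      have e3 : E * (E * F * Nᵀ) * Bᵀ = F * Nᵀ * Bᵀ := by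
        rw [Matrix.mul_assoc E F, ← Matrix.mul_assoc E E, hEE, Matrix.one_mul]
      have e4 : E * (E * F * Bᵀ) * Nᵀ = F * Bᵀ * Nᵀ := by
        rw [Matrix.mul_assoc E F, ← Matrix.mul_assoc E E, hEE, Matrix.one_mul]
      rw [e1, e2, e3, Matrix.mul_neg, Matrix.neg_mul, e4, hQ]
      simp only [transpose_sub, transpose_mul, transpose_one, Matrix.mul_sub, Matrix.mul_one,
        Matrix.mul_assoc]
      abel
    refine ⟨?_, _, h1⟩
    have hQB : Qᵀ * Bᵀ = 0 := by
      rw [← transpose_mul, hQ]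
      have : B * (1 - B * N - N * B) = B - B * B * N - B * N * B := by noncomm_ring
      rw [this, hB.mul_self, hN]
      simp
    have hBQ : Bᵀ * Qᵀ = 0 := by
      rw [← transpose_mul, hQ]
      have : (1 - B * N - N * B) * B = B - B * N * B - N * (B * B) := by noncomm_ring
      rw [this, hB.mul_self, hN]
      simp
    have e2 : A * F = -(E * F * Bᵀ) := eq_neg_of_add_eq_zero_left hF
    rw [← Matrix.mul_assoc A, e2]
    simp only [Matrix.mul_assoc, Matrix.neg_mul, hQB, hBQ, Matrix.mul_zero, neg_zero, add_zero]
  obtain ⟨c1, H1, h1⟩ := stepP _ hcyc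
  obtain ⟨c2, H2, h2⟩ := stepP _ c1
  obtain ⟨c3, H3, h3⟩ := stepQ _ c2
  obtain ⟨c4, H4, h4⟩ := stepQ _ c3
  -- Each projection is applied twice because `sq_apply_eq_zero` concerns its square.
  have hzero : P * (P * F) * Qᵀ * Qᵀ = 0 := by
    have : P * (P * F) * Qᵀ * Qᵀ = P * P * F * (Q * Q)ᵀ := by
      rw [transpose_mul]
      simp only [Matrix.mul_assoc]
    rw [this]
    ext x y
    rw [mul_apply]
    refine Finset.sum_eq_zero fun v _ => ?_
    rw [mul_apply, Finset.sum_mul]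
    refine Finset.sum_eq_zero fun u _ => ?_
    by_cases hu : F u v = 0
    · simp [hu]
    by_cases hi : HasHomology A dX (dX u)
    · rw [transpose_apply, sq_apply_eq_zero hB hN hNd (hno _ _ (hF u v hu) hi) rfl, mul_zero]
    · rw [sq_apply_eq_zero hA hM hMd hi rfl]
      simp
  refine hbd (H1 + H2 + H3 + H4) ?_
  simp only [Matrix.mul_add, Matrix.add_mul]
  have : F = (F - P * F) + (P * F - P * (P * F)) + (P * (P * F) - P * (P * F) * Qᵀ) +
      (P * (P * F) * Qᵀ - P * (P * F) * Qᵀ * Qᵀ) := by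
    rw [hzero]
    abel
  rw [this, ← h1, ← h2, ← h3, ← h4]
  abel

/-- The cycle `z ⊗ w` is no boundary: `p ⊗ q` vanishes on boundaries, but not on `z ⊗ w`. -/
theorem hasHomology_mul [DecidableEq X] {A : Matrix X X K}
    {B : Matrix Y Y K} {dX : X → ℕ} {dY : Y → ℕ} {i j : ℕ}
    (hi : HasHomology A dX i) (hj : HasHomology B dY j) :
    ∃ F : Matrix X Y K, (∀ x y, F x y ≠ 0 → dX x + dY y = i + j) ∧
      A * F + diagonal (fun x => (-1 : K) ^ dX x) * F * Bᵀ = 0 ∧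
      ∀ H : Matrix X Y K, A * H + diagonal (fun x => (-1 : K) ^ dX x) * H * Bᵀ ≠ F := by
  obtain ⟨z, hz, hz0, hzb⟩ := hi
  obtain ⟨w, hw, hw0, hwb⟩ := hj
  obtain ⟨p, hp, hpz⟩ := exists_vecMul_eq_zero hzb
  obtain ⟨q, hq, hqw⟩ := exists_vecMul_eq_zero hwb
  refine ⟨vecMulVec z w, fun x y h => ?_, ?_, fun H hH => ?_⟩
  · rw [vecMulVec_apply] at h
    rw [hz _ (left_ne_zero_of_mul h), hw _ (right_ne_zero_of_mul h)]
  · rw [mul_vecMulVec, hz0, Matrix.mul_assoc, vecMulVec_mul, vecMul_transpose, hw0]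
    ext x y
    simp [vecMulVec_apply, mul_apply]
  · have h := congrArg (fun T : Matrix X Y K => p ⬝ᵥ (T *ᵥ q)) hH
    simp only [add_mulVec, dotProduct_add] at h
    rw [dotProduct_mulVec, ← vecMul_vecMul, hp, ← mulVec_mulVec, mulVec_transpose, hq] at h
    have h2 : vecMulVec z w *ᵥ q = (q ⬝ᵥ w) • z := by
      ext x
      simp only [mulVec, dotProduct, vecMulVec_apply, Pi.smul_apply, smul_eq_mul, Finset.sum_mul]
      exact Finset.sum_congr rfl fun _ _ => by ring
    rw [h2, dotProduct_smul, smul_eq_mul] at h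
    simp only [zero_vecMul, zero_dotProduct, mulVec_zero, dotProduct_zero, add_zero] at h
    exact mul_ne_zero hqw hpz h.symm

/-- The Künneth formula for the tensor product of two complexes, as a statement about which
homology groups vanish. -/
theorem hasHomology_prod_iff [DecidableEq X] [DecidableEq Y] {A : Matrix X X K}
    {B : Matrix Y Y K} {dX : X → ℕ} {dY : Y → ℕ} (hA : IsDifferential A dX)
    (hB : IsDifferential B dY) {D : Matrix Z Z K} {dZ : Z → ℕ} (φ : X × Y ≃ Z)
    (hdeg : ∀ x y, dZ (φ (x, y)) = dX x + dY y)
    (hD : ∀ x y x' y', D (φ (x, y)) (φ (x', y')) =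
      (if y = y' then A x x' else 0) + (if x = x' then (-1) ^ dX x * B y y' else 0)) (n : ℕ) :
    HasHomology D dZ n ↔ ∃ i j, i + j = n ∧ HasHomology A dX i ∧ HasHomology B dY j := by
  have key : ∀ (F : Matrix X Y K) x y, (D *ᵥ fun z => F (φ.symm z).1 (φ.symm z).2) (φ (x, y)) =
      (A * F + diagonal (fun x => (-1 : K) ^ dX x) * F * Bᵀ) x y := by
    intro F x y
    rw [mulVec, dotProduct, ← φ.sum_comp, Fintype.sum_prod_type]
    simp only [hD, Equiv.symm_apply_apply, add_mul, ite_mul, zero_mul, Finset.sum_add_distrib,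
      Finset.sum_ite_eq, Finset.mem_univ, if_true, Matrix.add_apply]
    congr 1
    rw [Finset.sum_comm, mul_apply]
    simp only [Finset.sum_ite_eq, Finset.mem_univ, if_true, diagonal_mul, transpose_apply]
    exact Finset.sum_congr rfl fun _ _ => by ring
  have hfun : ∀ f : Z → K, f = fun z => (of fun x y => f (φ (x, y)) : Matrix X Y K)
      (φ.symm z).1 (φ.symm z).2 := by
    intro f
    ext z
    simp
  constructor
  · rintro ⟨f, hf, hf0, hfb⟩
    refine exists_of_hasHomology_mul hA hB (F := of fun x y => f (φ (x, y)))
      (fun x y h => by rw [← hdeg]; exact hf _ h) ?_ fun H hH => ?_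
    · ext x y
      rw [← key, ← hfun, hf0]
      rfl
    · refine hfb (fun z => H (φ.symm z).1 (φ.symm z).2) ?_
      ext z
      obtain ⟨⟨x, y⟩, rfl⟩ := φ.surjective z
      rw [key, hH, of_apply]
  · rintro ⟨i, j, rfl, hi, hj⟩
    obtain ⟨F, hF, hF0, hFb⟩ := hasHomology_mul hi hj
    refine ⟨fun z => F (φ.symm z).1 (φ.symm z).2, fun z h => ?_, ?_, fun g hg => ?_⟩
    · obtain ⟨⟨x, y⟩, rfl⟩ := φ.surjective z
      rw [hdeg]
      exact hF _ _ (by simpa using h)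
    · ext z
      obtain ⟨⟨x, y⟩, rfl⟩ := φ.surjective z
      rw [key, hF0]
      rfl
    · refine hFb (of fun x y => g (φ (x, y))) ?_
      ext x y
      rw [← key, ← hfun, hg]
      simp

end MatrixComplex

/-! ### Upper Koszul complexes -/

section Faces

open Matrix

variable {σ K : Type*} [LinearOrder σ] [Field K]

/-- The exponent vector of the squarefree monomial with support `S`. -/
def indicatorExponent (S : Finset σ) (a : σ) : ℕ := if a ∈ S then 1 else 0

theorem indicatorExponent_insert {a : σ} {S : Finset σ} (ha : a ∉ S) (b : σ) :
    indicatorExponent (insert a S) b = indicatorExponent S b + if b = a then 1 else 0 := by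
  simp only [indicatorExponent, Finset.mem_insert]
  by_cases hb : b = a
  · subst hb
    simp [ha]
  · simp [hb]

/-- `S` is a face of the upper Koszul complex in degree `α` of the monomial ideal generated by the
monomials with exponents in `s`. -/
def IsFace (s : Set (σ → ℕ)) (α : σ → ℕ) (S : Finset σ) : Prop :=
  ∃ u ∈ s, ∀ a, u a + indicatorExponent S a ≤ α a

theorem IsFace.mono {s : Set (σ → ℕ)} {α : σ → ℕ} {S T : Finset σ} (h : IsFace s α T)
    (hST : S ⊆ T) : IsFace s α S := by
  obtain ⟨u, hu, hle⟩ := h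
  refine ⟨u, hu, fun a => le_trans ?_ (hle a)⟩
  have : indicatorExponent S a ≤ indicatorExponent T a := by
    simp only [indicatorExponent]
    by_cases ha : a ∈ S
    · simp [ha, hST ha]
    · simp [ha]
  omega

/-- The faces of the upper Koszul complex in degree `α`. -/
abbrev Faces (s : Set (σ → ℕ)) (α : σ → ℕ) := {S : Finset σ // IsFace s α S}

/-- The sign of `insert a S` in the boundary. -/
def koszulSign (K : Type*) [Field K] (a : σ) (S : Finset σ) : K :=
  (-1) ^ (S.filter (· < a)).card

theorem koszulSign_mul_self (a : σ) (S : Finset σ) :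
    koszulSign K a S * koszulSign K a S = 1 := by
  rw [koszulSign, ← mul_pow]
  simp

theorem koszulSign_insert {a b : σ} {S : Finset σ} (ha : a ∉ S) :
    koszulSign K b (insert a S) = koszulSign K b S * if a < b then -1 else 1 := by
  simp only [koszulSign, Finset.filter_insert]
  split_ifs with h
  · rw [Finset.card_insert_of_notMem (by simp [ha]), pow_succ]
  · rw [mul_one]

/-- Exactly one of the two insertions is passed by the other. This yields both `∂² = 0` and the cone
homotopy. -/
theorem koszulSign_mul_koszulSign_insert {a b : σ} {S : Finset σ} (hab : a ≠ b) (ha : a ∉ S)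
    (hb : b ∉ S) : koszulSign K a S * koszulSign K b (insert a S) =
      -(koszulSign K b S * koszulSign K a (insert b S)) := by
  rw [koszulSign_insert ha, koszulSign_insert hb]
  rcases lt_or_gt_of_ne hab with h | h
  · rw [if_pos h, if_neg h.not_gt]
    ring
  · rw [if_pos h, if_neg h.not_gt]
    ring

/-- The extension by zero of a function on the faces. -/
noncomputable def extendFaces {s : Set (σ → ℕ)} {α : σ → ℕ} (f : Faces s α → K) : Finset σ → K :=
  Function.extend Subtype.val f 0

theorem extendFaces_apply {s : Set (σ → ℕ)} {α : σ → ℕ} (f : Faces s α → K) (S : Faces s α) :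
    extendFaces f S.1 = f S :=
  Subtype.val_injective.extend_apply _ _ _

theorem extendFaces_of_not {s : Set (σ → ℕ)} {α : σ → ℕ} (f : Faces s α → K) {S : Finset σ}
    (hS : ¬ IsFace s α S) : extendFaces f S = 0 :=
  Function.extend_apply' _ _ _ (by rintro ⟨T, rfl⟩; exact hS T.2)

variable [Fintype σ]

theorem sum_indicatorExponent (S : Finset σ) : ∑ a, indicatorExponent S a = S.card := by
  simp [indicatorExponent]

noncomputable instance (s : Set (σ → ℕ)) (α : σ → ℕ) : Fintype (Faces s α) := Fintype.ofFinite _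

/-- The boundary matrix of the upper Koszul complex in degree `α`. -/
noncomputable def faceMatrix (K : Type*) [Field K] (s : Set (σ → ℕ)) (α : σ → ℕ) :
    Matrix (Faces s α) (Faces s α) K :=
  of fun S T => ∑ a : σ, if a ∉ S.1 ∧ insert a S.1 = T.1 then koszulSign K a S.1 else 0

theorem faceMatrix_mulVec {s : Set (σ → ℕ)} {α : σ → ℕ} (f : Faces s α → K) (S : Faces s α) :
    (faceMatrix K s α *ᵥ f) S =
      ∑ a : σ, if a ∉ S.1 then koszulSign K a S.1 * extendFaces f (insert a S.1) else 0 := by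
  simp only [mulVec, dotProduct, faceMatrix, of_apply, Finset.sum_mul]
  rw [Finset.sum_comm]
  refine Finset.sum_congr rfl fun a _ => ?_
  by_cases ha : a ∉ S.1
  · rw [if_pos ha]
    by_cases hf : IsFace s α (insert a S.1)
    · rw [Finset.sum_eq_single ⟨_, hf⟩]
      · rw [if_pos ⟨ha, rfl⟩, extendFaces_apply f ⟨_, hf⟩]
      · rintro T - hT
        rw [if_neg, zero_mul]
        rintro ⟨-, h⟩
        exact hT (Subtype.ext h.symm)
      · simp
    · rw [extendFaces_of_not f hf, mul_zero]
      refine Finset.sum_eq_zero fun T _ => ?_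
      rw [if_neg, zero_mul]
      rintro ⟨-, h⟩
      exact hf (h ▸ T.2)
  · rw [if_neg ha]
    exact Finset.sum_eq_zero fun T _ => by simp [ha]

/-- Faces are closed under subsets, so off the faces both sides vanish. -/
theorem extendFaces_faceMatrix_mulVec {s : Set (σ → ℕ)} {α : σ → ℕ} (f : Faces s α → K)
    (S : Finset σ) : extendFaces (faceMatrix K s α *ᵥ f) S =
      ∑ a : σ, if a ∉ S then koszulSign K a S * extendFaces f (insert a S) else 0 := by
  by_cases hS : IsFace s α S
  · rw [extendFaces_apply _ ⟨S, hS⟩, faceMatrix_mulVec]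
  · rw [extendFaces_of_not _ hS]
    refine (Finset.sum_eq_zero fun a _ => ?_).symm
    rw [extendFaces_of_not f fun h => hS (h.mono (Finset.subset_insert _ _))]
    simp

/-- The degree of a face. -/
def faceDegree {s : Set (σ → ℕ)} {α : σ → ℕ} (S : Faces s α) : ℕ := S.1.card

theorem isDifferential_faceMatrix (s : Set (σ → ℕ)) (α : σ → ℕ) :
    IsDifferential (faceMatrix K s α) faceDegree where
  degree_eq S T h := by
    obtain ⟨a, -, ha⟩ := Finset.exists_ne_zero_of_sum_ne_zero h
    by_cases h' : a ∉ S.1 ∧ insert a S.1 = T.1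
    · rw [faceDegree, ← h'.2, Finset.card_insert_of_notMem h'.1, faceDegree]
    · exact absurd (if_neg h') ha
  mul_self := by
    have key : ∀ f : Faces s α → K, faceMatrix K s α *ᵥ (faceMatrix K s α *ᵥ f) = 0 := by
      intro f
      ext S
      rw [faceMatrix_mulVec]
      simp only [extendFaces_faceMatrix_mulVec, Pi.zero_apply]
      have : ∀ a : σ, (if a ∉ S.1 then koszulSign K a S.1 * ∑ b : σ, (if b ∉ insert a S.1 then
          koszulSign K b (insert a S.1) * extendFaces f (insert b (insert a S.1)) else 0) else 0) =
          ∑ b : σ, if a ∉ S.1 ∧ b ∉ insert a S.1 then koszulSign K a S.1 *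
            koszulSign K b (insert a S.1) * extendFaces f (insert b (insert a S.1)) else 0 := by
        intro a
        by_cases ha : a ∉ S.1
        · rw [if_pos ha, Finset.mul_sum]
          refine Finset.sum_congr rfl fun b _ => ?_
          simp only [ha, not_false_eq_true, true_and, mul_ite, mul_zero, mul_assoc]
        · simp [ha]
      simp only [this]
      rw [← Fintype.sum_prod_type' (f := fun a b : σ => if a ∉ S.1 ∧ b ∉ insert a S.1 then
        koszulSign K a S.1 * koszulSign K b (insert a S.1) *
          extendFaces f (insert b (insert a S.1)) else 0)]
      -- The terms of `(a, b)` and `(b, a)` cancel.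
      refine Finset.sum_involution (fun p _ => p.swap) ?_ ?_ (by simp) (by simp)
      · rintro ⟨a, b⟩ -
        simp only [Prod.swap, Finset.mem_insert, not_or]
        by_cases h : a ∉ S.1 ∧ ¬ b = a ∧ b ∉ S.1
        · obtain ⟨h1, h2, h3⟩ := h
          rw [if_pos ⟨h1, h2, h3⟩, if_pos ⟨h3, fun h => h2 h.symm, h1⟩,
            koszulSign_mul_koszulSign_insert (Ne.symm h2) h1 h3, Finset.insert_comm]
          ring
        · rw [if_neg h, if_neg (by tauto), add_zero]
      · rintro ⟨a, b⟩ - hne heq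
        simp only [Prod.swap, Prod.mk.injEq] at heq
        obtain ⟨rfl, -⟩ := heq
        simp at hne
    refine ext_of_mulVec_single fun T => ?_
    rw [← mulVec_mulVec, key, zero_mulVec]

end Faces

open MvPolynomial Matrix

/-! ### Monomial ideals and nonvanishing of Betti numbers -/

section Betti

variable {σ K : Type*} [Fintype σ] [Field K]

/-- The ideal generated by the monomials with exponents in `s`. -/
noncomputable def monomialIdeal (K : Type*) {σ : Type*} [Field K] (s : Set (σ → ℕ)) :
    Ideal (MvPolynomial σ K) :=
  Ideal.span ((fun m => monomial m 1) '' {m : σ →₀ ℕ | ⇑m ∈ s})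

theorem mem_monomialIdeal {s : Set (σ → ℕ)} {f : MvPolynomial σ K} :
    f ∈ monomialIdeal K s ↔ ∀ m ∈ f.support, ∃ u ∈ s, ∀ a, u a ≤ m a := by
  rw [monomialIdeal, mem_ideal_span_monomial_image]
  refine forall₂_congr fun m _ => ⟨?_, ?_⟩
  · rintro ⟨u, hu, hle⟩
    exact ⟨u, hu, hle⟩
  · rintro ⟨u, hu, hle⟩
    exact ⟨Finsupp.equivFunOnFinite.symm u, by simpa using hu, fun a => by simpa using hle a⟩

theorem degree_eq_sum (m : σ →₀ ℕ) : m.degree = ∑ a, m a :=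
  Finset.sum_subset (Finset.subset_univ _) fun a _ ha => by simpa using ha

/-- `finrank` is `0` on infinite-dimensional spaces, so finiteness is what lets a nonzero Betti
number mean nonzero homology. -/
theorem finiteDimensional_koszulChains (I : Ideal (MvPolynomial σ K)) (i j : ℕ) :
    FiniteDimensional K (koszulChains I i j) := by
  have hfin : Set.Finite {m : σ →₀ ℕ | m.degree ≤ j} := Finsupp.finite_of_degree_le j
  have := hfin.to_subtype
  have hB : FiniteDimensional K (restrictSupport K {m : σ →₀ ℕ | m.degree ≤ j}) :=
    Module.Finite.of_basis (basisRestrictSupport K _)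
  let f : koszulChains I i j →ₗ[K] ((Fin i → σ) → restrictSupport K {m : σ →₀ ℕ | m.degree ≤ j}) :=
    LinearMap.pi fun v => LinearMap.codRestrict _
      ((LinearMap.proj v).comp (koszulChains I i j).subtype) fun c => by
        rw [mem_restrictSupport_iff]
        intro m hm
        have := (c.2.1 v).2 m hm
        simp only [Set.mem_ofPred_eq]
        omega
  refine FiniteDimensional.of_injective f fun c d h => ?_
  ext1
  funext v
  exact congrArg Subtype.val (congrFun h v)

theorem gradedBetti_ne_zero_iff (I : Ideal (MvPolynomial σ K)) (i j : ℕ) :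
    gradedBetti I i j ≠ 0 ↔ ∃ c ∈ koszulCycles I i j, c ∉ koszulBoundaries I i j := by
  have hle : koszulCycles I i j ≤ koszulChains I i j := by
    cases i with
    | zero => exact le_rfl
    | succ i => exact inf_le_left
  have := finiteDimensional_koszulChains I i j
  have : FiniteDimensional K (koszulCycles I i j) := Submodule.finiteDimensional_of_le hle
  rw [gradedBetti, Ne, Module.finrank_eq_zero_iff_of_free, Submodule.Quotient.subsingleton_iff,
    Submodule.submoduleOf, Submodule.comap_subtype_eq_top, SetLike.not_le_iff_exists]

end Betti

/-! ### Multigraded decomposition of the Koszul complex -/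

section Monomial

variable {σ K : Type*} [LinearOrder σ] [Field K]

/-- Moving a new element of a sorted tuple from the front to its place costs `koszulSign`. -/
theorem exists_cons_comp_eq_orderEmbOfFin {i : ℕ} {a : σ} {S : Finset σ} (hS : S.card = i)
    (h : (insert a S).card = i + 1) :
    ∃ π : Equiv.Perm (Fin (i + 1)),
      (Fin.cons a (S.orderEmbOfFin hS) : Fin (i + 1) → σ) =
        (insert a S).orderEmbOfFin h ∘ π ∧
      ((Equiv.Perm.sign π : ℤ) : K) = koszulSign K a S := by
  set w := (insert a S).orderEmbOfFin h
  obtain ⟨p, hp⟩ : ∃ p, w p = a := by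
    have : a ∈ Set.range w := by
      rw [Finset.range_orderEmbOfFin]
      simp
    exact this
  have hw : (fun k => w (p.succAbove k)) = S.orderEmbOfFin hS := by
    refine Finset.orderEmbOfFin_unique hS (fun k => ?_)
      (w.strictMono.comp (Fin.strictMono_succAbove p))
    have h1 : w (p.succAbove k) ∈ insert a S := Finset.orderEmbOfFin_mem _ _ _
    refine Finset.mem_of_mem_insert_of_ne h1 fun h2 => ?_
    exact Fin.succAbove_ne p k (w.injective (h2.trans hp.symm))
  -- The position `p` of `a` in the sorted tuple is the number of elements of `S` below `a`, and a
  -- cycle moving position `0` to `p` has sign `(-1) ^ p`.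
  refine ⟨p.cycleRange.symm, ?_, ?_⟩
  · rw [← Fin.insertNth_comp_cycleRange_symm p, ← hw]
    congr 1
    rw [← hp]
    exact Fin.insertNth_self_removeNth p w
  · rw [Equiv.Perm.sign_symm, Fin.sign_cycleRange, koszulSign]
    have hcard : (S.filter (· < a)).card = p := by
      have : S.filter (· < a) = (Finset.univ.filter (· < p)).map w.toEmbedding := by
        ext b
        simp only [Finset.mem_filter, Finset.mem_map, Finset.mem_univ, true_and,
          RelEmbedding.coe_toEmbedding]
        constructor
        · rintro ⟨hb, hlt⟩
          have : b ∈ Set.range w := by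
            rw [Finset.range_orderEmbOfFin]
            simp [hb]
          obtain ⟨q, rfl⟩ := this
          exact ⟨q, w.lt_iff_lt.1 (hp ▸ hlt), rfl⟩
        · rintro ⟨q, hq, rfl⟩
          have hlt : w q < a := hp ▸ w.lt_iff_lt.2 hq
          exact ⟨Finset.mem_of_mem_insert_of_ne (Finset.orderEmbOfFin_mem _ _ _) hlt.ne, hlt⟩
      rw [this, Finset.card_map, Finset.filter_gt_eq_Iio, Fin.card_Iio]
    rw [hcard]
    simp

theorem comp_sort_eq_orderEmbOfFin {i : ℕ} {v : Fin i → σ} (hv : Function.Injective v)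
    (h : (Finset.univ.image v).card = i) :
    v ∘ Tuple.sort v = (Finset.univ.image v).orderEmbOfFin h :=
  Finset.orderEmbOfFin_unique h (fun _ => Finset.mem_image_of_mem _ (Finset.mem_univ _))
    ((Tuple.monotone_sort v).strictMono_of_injective (hv.comp (Tuple.sort v).injective))

theorem card_image_univ {i : ℕ} {v : Fin i → σ} (hv : Function.Injective v) :
    (Finset.univ.image v).card = i := by
  rw [Finset.card_image_of_injective _ hv, Finset.card_univ, Fintype.card_fin]

variable [Fintype σ]

/-- The exponent of the coefficient of the face `S` in degree `α`. -/
noncomputable def faceExponent (α : σ → ℕ) (S : Finset σ) : σ →₀ ℕ :=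
  Finsupp.equivFunOnFinite.symm fun a => α a - indicatorExponent S a

theorem faceExponent_apply (α : σ → ℕ) (S : Finset σ) (a : σ) :
    faceExponent α S a = α a - indicatorExponent S a := rfl

/-- The part of multidegree `α` of a chain of the Koszul complex. -/
noncomputable def faceCoeff {i : ℕ} (s : Set (σ → ℕ)) (α : σ → ℕ)
    (c : (Fin i → σ) → MvPolynomial σ K) (S : Faces s α) : K :=
  if h : S.1.card = i then coeff (faceExponent α S.1) (c (S.1.orderEmbOfFin h)) else 0

theorem faceCoeff_sub {i : ℕ} (s : Set (σ → ℕ)) (α : σ → ℕ)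
    (c d : (Fin i → σ) → MvPolynomial σ K) :
    faceCoeff s α (c - d) = faceCoeff s α c - faceCoeff s α d := by
  ext S
  simp only [faceCoeff, Pi.sub_apply]
  split_ifs <;> simp

theorem faceCoeff_degree {i : ℕ} (s : Set (σ → ℕ)) (α : σ → ℕ)
    (c : (Fin i → σ) → MvPolynomial σ K) (S : Faces s α) (h : faceCoeff s α c S ≠ 0) :
    faceDegree S = i := by
  by_contra h'
  exact h (dif_neg h')

/-- Passing to the part of multidegree `α` is a chain map: multiplication by `X a` and removal of
`e_a` balance in the multidegree. -/
theorem faceCoeff_koszulD {s : Set (σ → ℕ)} {i j : ℕ}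
    {c : (Fin (i + 1) → σ) → MvPolynomial σ K} (hc : c ∈ koszulChains (monomialIdeal K s) (i + 1) j)
    (α : σ → ℕ) : faceCoeff s α (koszulD σ K i c) = faceMatrix K s α *ᵥ faceCoeff s α c := by
  obtain ⟨h1, h2, h3⟩ := hc
  ext S
  rw [faceMatrix_mulVec, faceCoeff]
  split_ifs with hS
  · change coeff _ (∑ a : σ, X a * c (Fin.cons a (S.1.orderEmbOfFin hS))) = _
    rw [coeff_sum]
    refine Finset.sum_congr rfl fun a _ => ?_
    by_cases ha : a ∈ S.1
    · rw [if_neg (not_not.2 ha), h2, mul_zero, coeff_zero]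
      intro hinj
      have hr : a ∈ Set.range (S.1.orderEmbOfFin hS) := by
        rw [Finset.range_orderEmbOfFin]
        exact ha
      exact (Fin.cons_injective_iff.1 hinj).1 hr
    · rw [if_pos ha, coeff_X_mul']
      have hcard : (insert a S.1).card = i + 1 := by
        rw [Finset.card_insert_of_notMem ha, hS]
      obtain ⟨π, hπ, hsign⟩ := exists_cons_comp_eq_orderEmbOfFin (K := K) hS hcard
      have hexp : faceExponent α S.1 - Finsupp.single a 1 = faceExponent α (insert a S.1) := by
        ext b
        rw [Finsupp.tsub_apply, faceExponent_apply, faceExponent_apply,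
          indicatorExponent_insert ha, Finsupp.single_apply, Nat.sub_sub]
        simp [eq_comm]
      have hcoeff : coeff (faceExponent α (insert a S.1))
          (c (Fin.cons a (S.1.orderEmbOfFin hS))) = koszulSign K a S.1 *
          coeff (faceExponent α (insert a S.1)) (c ((insert a S.1).orderEmbOfFin hcard)) := by
        rw [hπ, h3, ← hsign, ← Int.cast_smul_eq_zsmul K, coeff_smul, smul_eq_mul]
      have hSa : indicatorExponent S.1 a = 0 := by simp [indicatorExponent, ha]
      by_cases hf : IsFace s α (insert a S.1)
      · rw [extendFaces_apply _ ⟨_, hf⟩, faceCoeff, dif_pos hcard, if_pos, hexp, hcoeff]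
        obtain ⟨u, -, hu⟩ := hf
        have := hu a
        rw [indicatorExponent_insert ha, if_pos rfl] at this
        rw [Finsupp.mem_support_iff, faceExponent_apply]
        omega
      · rw [extendFaces_of_not _ hf, mul_zero]
        split_ifs with hsupp
        · by_contra hne
          rw [hexp] at hne
          obtain ⟨u, hu, hle⟩ := mem_monomialIdeal.1 (h1 _).1 _ (mem_support_iff.2 hne)
          refine hf ⟨u, hu, fun b => ?_⟩
          have hb := hle b
          rw [faceExponent_apply] at hb
          -- This bound ensures that the subtraction in `faceExponent` is not truncated.
          have hα : indicatorExponent (insert a S.1) b ≤ α b := by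
            obtain ⟨v, -, hv⟩ := S.2
            have := hv b
            rw [indicatorExponent_insert ha]
            split_ifs with hba
            · subst hba
              rw [Finsupp.mem_support_iff, faceExponent_apply] at hsupp
              omega
            · omega
          omega
        · rfl
  · refine (Finset.sum_eq_zero fun a _ => ?_).symm
    by_cases ha : a ∈ S.1
    · rw [if_neg (not_not.2 ha)]
    · rw [if_pos ha]
      by_cases hf : IsFace s α (insert a S.1)
      · rw [extendFaces_apply _ ⟨_, hf⟩, faceCoeff, dif_neg, mul_zero]
        rw [Finset.card_insert_of_notMem ha]
        omega
      · rw [extendFaces_of_not _ hf, mul_zero]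

/-- A chain is determined by its multigraded parts. -/
theorem eq_zero_of_faceCoeff_eq_zero {s : Set (σ → ℕ)} {i j : ℕ}
    {c : (Fin i → σ) → MvPolynomial σ K} (hc : c ∈ koszulChains (monomialIdeal K s) i j)
    (h : ∀ α, ∑ a, α a = j → faceCoeff s α c = 0) : c = 0 := by
  obtain ⟨h1, h2, h3⟩ := hc
  ext v m
  by_cases hv : Function.Injective v
  · rw [Pi.zero_apply, coeff_zero]
    by_contra hne
    obtain ⟨hI, hdeg⟩ := h1 v
    obtain ⟨u, hu, hle⟩ := mem_monomialIdeal.1 hI m (mem_support_iff.2 hne)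
    have hm := hdeg m (mem_support_iff.2 hne)
    set S := Finset.univ.image v
    have hcard : S.card = i := card_image_univ hv
    -- This is the multidegree of the monomial `m` times the wedge indexed by `v`.
    set α : σ → ℕ := fun a => m a + indicatorExponent S a
    have hα : ∑ a, α a = j := by
      rw [Finset.sum_add_distrib, sum_indicatorExponent, ← degree_eq_sum, hcard, hm]
    have hS : IsFace s α S := ⟨u, hu, fun a => Nat.add_le_add_right (hle a) _⟩
    have h0 := congrFun (h α hα) ⟨S, hS⟩
    have hexp : faceExponent α S = m := by
      ext a
      simp [faceExponent_apply, α]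
    rw [faceCoeff, dif_pos hcard, hexp, ← comp_sort_eq_orderEmbOfFin hv hcard, h3,
      ← Int.cast_smul_eq_zsmul K, coeff_smul, smul_eq_mul] at h0
    rcases mul_eq_zero.1 h0 with h0 | h0
    · rcases Int.units_eq_one_or (Equiv.Perm.sign (Tuple.sort v)) with h' | h' <;>
        simp [h'] at h0
    · exact hne h0
  · rw [h2 v hv, Pi.zero_apply]

open Classical in
/-- The chain of the Koszul complex of degree `j` with prescribed multigraded parts. -/
noncomputable def chainOfFaces {s : Set (σ → ℕ)} (i j : ℕ) (b : ∀ α, Faces s α → K)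
    (v : Fin i → σ) : MvPolynomial σ K :=
  if Function.Injective v then (Equiv.Perm.sign (Tuple.sort v) : ℤ) •
    ∑ α ∈ Finset.piAntidiag Finset.univ j, monomial (faceExponent α (Finset.univ.image v))
      (extendFaces (b α) (Finset.univ.image v)) else 0

theorem chainOfFaces_mem {s : Set (σ → ℕ)} (i j : ℕ) (b : ∀ α, Faces s α → K) :
    chainOfFaces i j b ∈ koszulChains (monomialIdeal K s) i j := by
  refine ⟨fun v => ?_, fun v hv => if_neg hv, fun π v => ?_⟩
  · rw [chainOfFaces]
    split_ifs with hv
    · refine zsmul_mem (Submodule.sum_mem _ fun α hα => ?_) _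
      set S := Finset.univ.image v
      have hcard : S.card = i := card_image_univ hv
      by_cases hS : IsFace s α S
      · obtain ⟨u, hu, hle⟩ := hS
        refine ⟨mem_monomialIdeal.2 fun m hm => ?_, fun m hm => ?_⟩
        all_goals
          rw [Finset.mem_singleton.1 (support_monomial_subset hm)]
        · refine ⟨u, hu, fun a => ?_⟩
          have := hle a
          rw [faceExponent_apply]
          omega
        · have hsum : ∑ a, α a = j := (Finset.mem_piAntidiag.1 hα).1
          rw [degree_eq_sum, ← hsum, ← hcard, ← sum_indicatorExponent, ← Finset.sum_add_distrib]
          refine Finset.sum_congr rfl fun a _ => ?_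
          have := hle a
          rw [faceExponent_apply]
          omega
      · rw [extendFaces_of_not _ hS, monomial_zero]
        exact Submodule.zero_mem _
    · exact Submodule.zero_mem _
  · by_cases hv : Function.Injective v
    · have himg : Finset.univ.image (v ∘ π) = Finset.univ.image v := by
        ext a
        simp only [Finset.mem_image, Finset.mem_univ, true_and, Function.comp_apply]
        exact π.exists_congr_left.trans (by simp)
      -- The sorting permutation of an injective tuple is unique; its sign makes the chain
      -- alternating.
      have hsort : Tuple.sort (v ∘ π) = π⁻¹ * Tuple.sort v := by
        symm
        rw [Tuple.eq_sort_iff]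
        refine ⟨?_, fun k l hkl h => ?_⟩
        · have : (v ∘ π) ∘ (π⁻¹ * Tuple.sort v : Equiv.Perm (Fin i)) = v ∘ Tuple.sort v := by
            ext k
            simp
          rw [this]
          exact Tuple.monotone_sort v
        · exact absurd ((π⁻¹ * Tuple.sort v).injective ((hv.comp π.injective) h)) hkl.ne
      rw [chainOfFaces, chainOfFaces, if_pos (hv.comp π.injective), if_pos hv, himg, hsort, smul_smul]
      simp
    · rw [chainOfFaces, chainOfFaces, if_neg hv, if_neg, smul_zero]
      intro h
      exact hv (by simpa [Function.comp_assoc] using h.comp π.symm.injective)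

theorem faceCoeff_chainOfFaces {s : Set (σ → ℕ)} (i j : ℕ) (b : ∀ α, Faces s α → K)
    {α : σ → ℕ} (hα : ∑ a, α a = j) (S : Faces s α) :
    faceCoeff s α (chainOfFaces i j b) S = if faceDegree S = i then b α S else 0 := by
  rw [faceCoeff, faceDegree]
  split_ifs with hS
  · have himg : Finset.univ.image (S.1.orderEmbOfFin hS) = S.1 := by
      apply Finset.coe_injective
      rw [Finset.coe_image, Finset.coe_univ, Set.image_univ, Finset.range_orderEmbOfFin]
    have hsort : Tuple.sort (S.1.orderEmbOfFin hS) = 1 :=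
      Tuple.sort_eq_refl_iff_monotone.2 (S.1.orderEmbOfFin hS).monotone
    rw [chainOfFaces, if_pos (S.1.orderEmbOfFin hS).injective, himg, hsort]
    simp only [Equiv.Perm.sign_one, Units.val_one, one_smul, coeff_sum, coeff_monomial]
    rw [Finset.sum_eq_single α]
    · rw [if_pos rfl, extendFaces_apply]
    · intro β _ hβ
      split_ifs with h
      -- If `S` is a face in both degrees, neither subtraction is truncated, so equal exponents
      -- force `β = α`.
      · refine extendFaces_of_not _ fun hf => hβ ?_
        obtain ⟨u, -, hu⟩ := hf
        obtain ⟨v, -, hv⟩ := S.2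
        ext a
        have h1 := hu a
        have h2 := hv a
        have h3 := DFunLike.congr_fun h a
        rw [faceExponent_apply, faceExponent_apply] at h3
        omega
      · rfl
    · intro h
      exact absurd (Finset.mem_piAntidiag.2 ⟨hα, by simp⟩) h
  · rfl

/-- A preimage may be truncated to degree `i + 1`, the only degree that `chainOfFaces` retains. -/
theorem exists_mulVec_eq_of_degree {X : Type*} [Fintype X] {A : Matrix X X K} {deg : X → ℕ}
    (hA : IsDifferential A deg) {f : X → K} {i : ℕ} (hf : ∀ x, f x ≠ 0 → deg x = i)
    {g : X → K} (hg : A *ᵥ g = f) :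
    A *ᵥ (fun x => if deg x = i + 1 then g x else 0) = f := by
  ext x
  by_cases hx : deg x = i
  · rw [← hg]
    simp only [mulVec, dotProduct]
    refine Finset.sum_congr rfl fun y _ => ?_
    by_cases hxy : A x y = 0
    · rw [hxy, zero_mul, zero_mul]
    · rw [if_pos (by rw [hA.degree_eq _ _ hxy, hx])]
  · have : f x = 0 := by
      by_contra h
      exact hx (hf _ h)
    rw [this]
    simp only [mulVec, dotProduct]
    refine Finset.sum_eq_zero fun y _ => ?_
    by_cases hxy : A x y = 0
    · rw [hxy, zero_mul]
    · have := hA.degree_eq _ _ hxy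
      rw [if_neg (by omega), mul_zero]

/-- The degree `j` complex is the direct sum of its parts of multidegree `α` with `|α| = j`.
Preimages found in each part assemble into one chain, and a class in one part extends by zero to the
others. -/
theorem exists_mem_koszulCycles_iff (s : Set (σ → ℕ)) (i j : ℕ) :
    (∃ c ∈ koszulCycles (monomialIdeal K s) i j, c ∉ koszulBoundaries (monomialIdeal K s) i j) ↔
      ∃ α : σ → ℕ, ∑ a, α a = j ∧ HasHomology (faceMatrix K s α) faceDegree i := by
  constructor
  · rintro ⟨c, hc, hcb⟩
    by_contra! hno
    have hchain : c ∈ koszulChains (monomialIdeal K s) i j := by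
      cases i with
      | zero => exact hc
      | succ i => exact hc.1
    have hcyc : ∀ α, faceMatrix K s α *ᵥ faceCoeff s α c = 0 := by
      intro α
      cases i with
      -- Here `koszulCycles` imposes no kernel condition, but the face differential vanishes on the
      -- empty face.
      | zero =>
        ext S
        simp only [mulVec, dotProduct]
        refine Finset.sum_eq_zero fun T _ => ?_
        by_cases h1 : faceMatrix K s α S T = 0
        · rw [h1, zero_mul]
        by_cases h2 : faceCoeff s α c T = 0
        · rw [h2, mul_zero]
        have h1 := (isDifferential_faceMatrix s α).degree_eq _ _ h1
        have h2 := faceCoeff_degree s α c T h2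
        omega
      | succ i =>
        rw [← faceCoeff_koszulD hchain, LinearMap.mem_ker.1 hc.2]
        ext S
        simp [faceCoeff]
    have hex : ∀ α : σ → ℕ, ∃ g : Faces s α → K, ∑ a, α a = j →
        faceMatrix K s α *ᵥ g = faceCoeff s α c := by
      intro α
      by_cases hα : ∑ a, α a = j
      · by_contra! h
        exact hno α hα ⟨faceCoeff s α c, faceCoeff_degree s α c, hcyc α, fun g => (h g).2⟩
      · exact ⟨0, fun h => absurd h hα⟩
    choose b hb using hex
    have hmem := chainOfFaces_mem (s := s) (i + 1) j b
    refine hcb ⟨_, hmem, ?_⟩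
    rw [← sub_eq_zero]
    refine eq_zero_of_faceCoeff_eq_zero
      (Submodule.sub_mem _ (koszulD_mem_koszulChains _ i j hmem) hchain) fun α hα => ?_
    rw [faceCoeff_sub, faceCoeff_koszulD hmem, sub_eq_zero]
    rw [← exists_mulVec_eq_of_degree (isDifferential_faceMatrix s α) (faceCoeff_degree s α c)
      (hb α hα)]
    congr 1
    ext S
    exact faceCoeff_chainOfFaces (i + 1) j b hα S
  · rintro ⟨α, hα, f, hf, hf0, hfb⟩
    set c := chainOfFaces (s := s) i j (Pi.single α f)
    have hmem : c ∈ koszulChains (monomialIdeal K s) i j := chainOfFaces_mem i j _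
    have hself : faceCoeff s α c = f := by
      ext S
      rw [faceCoeff_chainOfFaces i j _ hα, Pi.single_eq_same]
      split_ifs with h
      · rfl
      · by_contra h'
        exact h (hf _ (Ne.symm h'))
    have hne : ∀ β, ∑ a, β a = j → β ≠ α → faceCoeff s β c = 0 := by
      intro β hβ hβα
      ext S
      rw [faceCoeff_chainOfFaces i j _ hβ, Pi.single_eq_of_ne hβα]
      simp
    refine ⟨c, ?_, ?_⟩
    · cases i with
      | zero => exact hmem
      | succ i =>
        refine ⟨hmem, LinearMap.mem_ker.2 ?_⟩
        refine eq_zero_of_faceCoeff_eq_zero (koszulD_mem_koszulChains _ i j hmem) fun β hβ => ?_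
        rw [faceCoeff_koszulD hmem]
        by_cases hβα : β = α
        · subst hβα
          rw [hself, hf0]
        · rw [hne β hβ hβα, mulVec_zero]
    · rintro ⟨b, hb, hbc⟩
      refine hfb (faceCoeff s α b) ?_
      rw [← faceCoeff_koszulD hb, hbc, hself]

theorem gradedBetti_monomialIdeal_ne_zero_iff (s : Set (σ → ℕ)) (i j : ℕ) :
    gradedBetti (monomialIdeal K s) i j ≠ 0 ↔
      ∃ α : σ → ℕ, ∑ a, α a = j ∧ HasHomology (faceMatrix K s α) faceDegree i := by
  rw [gradedBetti_ne_zero_iff, exists_mem_koszulCycles_iff]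

end Monomial

/-! ### Acyclicity in multidegrees that are not squarefree -/

section Cone

variable {σ K : Type*} [LinearOrder σ] [Fintype σ] [Field K]

/-- The upper Koszul complex of a squarefree monomial ideal is a cone in each degree which is not
squarefree. -/
theorem not_hasHomology_of_one_lt {s : Set (σ → ℕ)} (hs : ∀ u ∈ s, ∀ a, u a ≤ 1) {α : σ → ℕ}
    {a : σ} (ha : 1 < α a) (i : ℕ) : ¬ HasHomology (faceMatrix K s α) faceDegree i := by
  -- Generators have exponent at most `1` in `a` while `α a ≥ 2`, so there is always room for `a`:
  -- it is the apex of a cone.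
  have hface : ∀ S, IsFace s α (S.erase a) → IsFace s α S := by
    rintro S ⟨u, hu, hle⟩
    refine ⟨u, hu, fun b => ?_⟩
    by_cases hb : b = a
    · subst hb
      have h1 := hs u hu b
      have h2 : indicatorExponent S b ≤ 1 := by
        rw [indicatorExponent]
        split_ifs <;> simp
      omega
    · have h1 := hle b
      have h2 : indicatorExponent (S.erase a) b = indicatorExponent S b := by
        simp [indicatorExponent, hb]
      omega
  rintro ⟨f, -, hf0, hfb⟩
  -- The preimage of the cycle `f` is its cone with apex `a`.
  refine hfb (fun S => if a ∈ S.1 then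
    koszulSign K a (S.1.erase a) * extendFaces f (S.1.erase a) else 0) ?_
  set g : Faces s α → K := fun S => if a ∈ S.1 then
    koszulSign K a (S.1.erase a) * extendFaces f (S.1.erase a) else 0
  have hg : ∀ T, extendFaces g T = if a ∈ T then
      koszulSign K a (T.erase a) * extendFaces f (T.erase a) else 0 := by
    intro T
    by_cases hT : IsFace s α T
    · rw [extendFaces_apply g ⟨T, hT⟩]
    · rw [extendFaces_of_not _ hT, extendFaces_of_not f fun h => hT (hface _ h)]
      simp
  ext S
  rw [faceMatrix_mulVec]
  simp only [hg]
  by_cases haS : a ∈ S.1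
  · have hS' : IsFace s α (S.1.erase a) := S.2.mono (Finset.erase_subset _ _)
    -- The cycle condition at `S` without `a` expresses `f S` through the remaining terms of the
    -- boundary of the cone.
    have hcyc := congrFun hf0 ⟨_, hS'⟩
    rw [faceMatrix_mulVec, ← Finset.add_sum_erase _ _ (Finset.mem_univ a)] at hcyc
    rw [← Finset.add_sum_erase _ _ (Finset.mem_univ a)]
    simp only [Finset.notMem_erase, not_false_eq_true, if_true, Finset.insert_erase haS,
      extendFaces_apply, Pi.zero_apply] at hcyc
    rw [if_neg (not_not.2 haS), zero_add]
    have hterm : ∀ b ∈ Finset.univ.erase a, (if b ∉ S.1 then koszulSign K b S.1 *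
        (if a ∈ insert b S.1 then koszulSign K a ((insert b S.1).erase a) *
          extendFaces f ((insert b S.1).erase a) else 0) else 0) =
        -koszulSign K a (S.1.erase a) * (if b ∉ S.1.erase a then koszulSign K b (S.1.erase a) *
          extendFaces f (insert b (S.1.erase a)) else 0) := by
      intro b hb
      have hba : b ≠ a := Finset.ne_of_mem_erase hb
      by_cases hbS : b ∈ S.1
      · rw [if_neg (not_not.2 hbS), if_neg (not_not.2 (Finset.mem_erase.2 ⟨hba, hbS⟩)), mul_zero]
      · have hbS' : b ∉ S.1.erase a := fun h => hbS (Finset.mem_of_mem_erase h)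
        rw [if_pos hbS, if_pos hbS', if_pos (Finset.mem_insert_of_mem haS),
          Finset.erase_insert_of_ne hba]
        have h1 := koszulSign_mul_koszulSign_insert (K := K) hba.symm (Finset.notMem_erase a S.1) hbS'
        rw [Finset.insert_erase haS] at h1
        have h2 := koszulSign_mul_self (K := K) a (S.1.erase a)
        have h3 := koszulSign_mul_self (K := K) a (insert b (S.1.erase a))
        linear_combination (extendFaces f (insert b (S.1.erase a))) *
          (koszulSign K a (S.1.erase a) * koszulSign K a (insert b (S.1.erase a)) * h1 -
            koszulSign K b S.1 * koszulSign K a (insert b (S.1.erase a)) * h2 -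
            koszulSign K a (S.1.erase a) * koszulSign K b (S.1.erase a) * h3)
    rw [Finset.sum_congr rfl hterm, ← Finset.mul_sum]
    have h2 := koszulSign_mul_self (K := K) a (S.1.erase a)
    linear_combination (-koszulSign K a (S.1.erase a)) * hcyc + f S * h2
  · rw [Finset.sum_eq_single a]
    · rw [if_pos haS, if_pos (Finset.mem_insert_self _ _), Finset.erase_insert haS,
        extendFaces_apply, ← mul_assoc, koszulSign_mul_self, one_mul]
    · intro b _ hb
      rw [if_neg (c := a ∈ insert b S.1), mul_zero, ite_self]
      rw [Finset.mem_insert, not_or]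
      exact ⟨Ne.symm hb, haS⟩
    · simp

end Cone

/-! ### Bounds for the indices of nonzero Betti numbers -/

section Support

variable {σ K : Type*} [Fintype σ] [Field K]

theorem exists_linearOrder (σ : Type*) [Fintype σ] : Nonempty (LinearOrder σ) :=
  ⟨LinearOrder.lift' (Fintype.equivFin σ) (Fintype.equivFin σ).injective⟩

/-- A nonzero class is supported on faces with `i` elements, and the indicator of a face is bounded
by `α`. -/
theorem le_of_gradedBetti_ne_zero {s : Set (σ → ℕ)} {i j : ℕ}
    (h : gradedBetti (monomialIdeal K s) i j ≠ 0) : i ≤ j ∧ i ≤ Fintype.card σ := by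
  obtain ⟨_⟩ := exists_linearOrder σ
  obtain ⟨α, rfl, f, hf, -, hfb⟩ := (gradedBetti_monomialIdeal_ne_zero_iff s i j).1 h
  obtain ⟨S, hS⟩ : ∃ S, f S ≠ 0 := by
    by_contra! h0
    exact hfb 0 (by rw [mulVec_zero]; ext S; simp [h0 S])
  rw [← hf S hS, faceDegree]
  refine ⟨?_, Finset.card_le_univ _⟩
  rw [← sum_indicatorExponent]
  obtain ⟨u, -, hu⟩ := S.2
  exact Finset.sum_le_sum fun a _ => le_trans (Nat.le_add_left _ _) (hu a)

theorem le_card_of_gradedBetti_ne_zero {s : Set (σ → ℕ)} (hs : ∀ u ∈ s, ∀ a, u a ≤ 1) {i j : ℕ}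
    (h : gradedBetti (monomialIdeal K s) i j ≠ 0) : j ≤ Fintype.card σ := by
  obtain ⟨_⟩ := exists_linearOrder σ
  obtain ⟨α, rfl, hα⟩ := (gradedBetti_monomialIdeal_ne_zero_iff s i j).1 h
  have hle : ∀ a, α a ≤ 1 := by
    by_contra! h1
    obtain ⟨a, ha⟩ := h1
    exact not_hasHomology_of_one_lt hs ha i hα
  exact (Finset.sum_le_sum fun a _ => hle a).trans (by simp)

theorem exists_gradedBetti_ne_zero {s : Set (σ → ℕ)} (hs : s.Nonempty) :
    ∃ j, gradedBetti (monomialIdeal K s) 0 j ≠ 0 := by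
  obtain ⟨_⟩ := exists_linearOrder σ
  set u := Function.argminOn (fun u : σ → ℕ => ∑ a, u a) s hs
  have hu : u ∈ s := Function.argminOn_mem _ _ _
  refine ⟨∑ a, u a, (gradedBetti_monomialIdeal_ne_zero_iff s _ _).2 ⟨u, rfl, ?_⟩⟩
  -- In the multidegree of a generator of least total degree, a nonempty face would need a generator
  -- of smaller degree.
  have hempty : ∀ S : Faces s u, S.1 = ∅ := by
    rintro ⟨S, v, hv, hle⟩
    have h1 : ∑ a, v a + S.card ≤ ∑ a, u a := by
      rw [← sum_indicatorExponent, ← Finset.sum_add_distrib]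
      exact Finset.sum_le_sum fun a _ => hle a
    have h2 : ∑ a, u a ≤ ∑ a, v a := Function.argminOn_le (fun u : σ → ℕ => ∑ a, u a) s hv
    exact Finset.card_eq_zero.1 (by omega : S.card = 0)
  have hA : faceMatrix K s u = 0 := by
    ext S T
    by_contra h
    have := (isDifferential_faceMatrix s u).degree_eq S T h
    rw [faceDegree, faceDegree, hempty S, hempty T] at this
    simp at this
  refine ⟨fun _ => 1, fun S _ => by rw [faceDegree, hempty S, Finset.card_empty], ?_, fun g hg => ?_⟩
  · rw [hA, zero_mulVec]
  · rw [hA, zero_mulVec] at hg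
    have := congrFun hg ⟨∅, u, hu, fun a => by simp [indicatorExponent]⟩
    simp at this

end Support

/-! ### Faces of products in disjoint variables -/

section Product

variable {σ τ ρ : Type*}

/-- Subsets of a disjoint union are pairs of subsets. -/
def finsetProdEquiv (e : σ ⊕ τ ≃ ρ) : Finset σ × Finset τ ≃ Finset ρ :=
  Finset.sumEquiv.symm.toEquiv.trans e.finsetCongr

theorem inl_mem_finsetProdEquiv (e : σ ⊕ τ ≃ ρ) (S : Finset σ) (T : Finset τ) (a : σ) :
    e (Sum.inl a) ∈ finsetProdEquiv e (S, T) ↔ a ∈ S := by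
  simp [finsetProdEquiv]

theorem inr_mem_finsetProdEquiv (e : σ ⊕ τ ≃ ρ) (S : Finset σ) (T : Finset τ) (b : τ) :
    e (Sum.inr b) ∈ finsetProdEquiv e (S, T) ↔ b ∈ T := by
  simp [finsetProdEquiv]

theorem card_finsetProdEquiv (e : σ ⊕ τ ≃ ρ) (S : Finset σ) (T : Finset τ) :
    (finsetProdEquiv e (S, T)).card = S.card + T.card := by
  simp [finsetProdEquiv]

theorem eq_finsetProdEquiv_iff (e : σ ⊕ τ ≃ ρ) {U : Finset ρ} {S : Finset σ} {T : Finset τ} :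
    U = finsetProdEquiv e (S, T) ↔
      (∀ a, e (Sum.inl a) ∈ U ↔ a ∈ S) ∧ ∀ b, e (Sum.inr b) ∈ U ↔ b ∈ T := by
  constructor
  · rintro rfl
    exact ⟨inl_mem_finsetProdEquiv e S T, inr_mem_finsetProdEquiv e S T⟩
  · rintro ⟨h1, h2⟩
    ext c
    obtain ⟨a | b, rfl⟩ := e.surjective c
    · rw [h1, inl_mem_finsetProdEquiv]
    · rw [h2, inr_mem_finsetProdEquiv]

theorem insert_inl_finsetProdEquiv [DecidableEq σ] [DecidableEq ρ] (e : σ ⊕ τ ≃ ρ)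
    (S : Finset σ) (T : Finset τ) (a : σ) :
    insert (e (Sum.inl a)) (finsetProdEquiv e (S, T)) = finsetProdEquiv e (insert a S, T) := by
  rw [eq_finsetProdEquiv_iff]
  simp [inl_mem_finsetProdEquiv, inr_mem_finsetProdEquiv]

theorem insert_inr_finsetProdEquiv [DecidableEq τ] [DecidableEq ρ] (e : σ ⊕ τ ≃ ρ)
    (S : Finset σ) (T : Finset τ) (b : τ) :
    insert (e (Sum.inr b)) (finsetProdEquiv e (S, T)) = finsetProdEquiv e (S, insert b T) := by
  rw [eq_finsetProdEquiv_iff]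
  simp [inl_mem_finsetProdEquiv, inr_mem_finsetProdEquiv]

variable [LinearOrder σ] [LinearOrder τ] [LinearOrder ρ]

/-- `e` identifies the order of `ρ` with the lexicographic order, in which `σ` comes before `τ`. -/
structure IsLexSum (e : σ ⊕ τ ≃ ρ) : Prop where
  inl_lt_inl : ∀ a a', e (Sum.inl a) < e (Sum.inl a') ↔ a < a'
  inr_lt_inr : ∀ b b', e (Sum.inr b) < e (Sum.inr b') ↔ b < b'
  inl_lt_inr : ∀ a b, e (Sum.inl a) < e (Sum.inr b)

variable {K : Type*} [Field K]

theorem IsLexSum.koszulSign_inl {e : σ ⊕ τ ≃ ρ} (he : IsLexSum e) (S : Finset σ) (T : Finset τ)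
    (a : σ) : koszulSign K (e (Sum.inl a)) (finsetProdEquiv e (S, T)) = koszulSign K a S := by
  have : (finsetProdEquiv e (S, T)).filter (· < e (Sum.inl a)) =
      finsetProdEquiv e (S.filter (· < a), ∅) := by
    rw [eq_finsetProdEquiv_iff]
    simp [inl_mem_finsetProdEquiv, he.inl_lt_inl, (he.inl_lt_inr _ _).le]
  rw [koszulSign, this, card_finsetProdEquiv, Finset.card_empty, add_zero, koszulSign]

/-- All of `S` precedes `b`, which produces the sign of the tensor product differential. -/
theorem IsLexSum.koszulSign_inr {e : σ ⊕ τ ≃ ρ} (he : IsLexSum e) (S : Finset σ) (T : Finset τ)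
    (b : τ) : koszulSign K (e (Sum.inr b)) (finsetProdEquiv e (S, T)) =
      (-1) ^ S.card * koszulSign K b T := by
  have : (finsetProdEquiv e (S, T)).filter (· < e (Sum.inr b)) =
      finsetProdEquiv e (S, T.filter (· < b)) := by
    rw [eq_finsetProdEquiv_iff]
    simp [inl_mem_finsetProdEquiv, inr_mem_finsetProdEquiv, he.inr_lt_inr, he.inl_lt_inr]
  rw [koszulSign, this, card_finsetProdEquiv, pow_add, koszulSign]

/-- The exponents in `w` are the pairs of an exponent in `s` and an exponent in `t`. -/
def IsExponentProd (e : σ ⊕ τ ≃ ρ) (s : Set (σ → ℕ)) (t : Set (τ → ℕ)) (w : Set (ρ → ℕ)) : Prop :=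
  ∀ u, u ∈ w ↔ (fun a => u (e (Sum.inl a))) ∈ s ∧ (fun b => u (e (Sum.inr b))) ∈ t

theorem IsExponentProd.isFace_iff {e : σ ⊕ τ ≃ ρ} {s : Set (σ → ℕ)} {t : Set (τ → ℕ)}
    {w : Set (ρ → ℕ)} (h : IsExponentProd e s t w) (γ : ρ → ℕ) (p : Finset σ × Finset τ) :
    IsFace s (fun a => γ (e (Sum.inl a))) p.1 ∧ IsFace t (fun b => γ (e (Sum.inr b))) p.2 ↔
      IsFace w γ (finsetProdEquiv e p) := by
  obtain ⟨S, T⟩ := p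
  have h1 : ∀ a, indicatorExponent (finsetProdEquiv e (S, T)) (e (Sum.inl a)) =
      indicatorExponent S a := fun a => by
    simp only [indicatorExponent, inl_mem_finsetProdEquiv]
  have h2 : ∀ b, indicatorExponent (finsetProdEquiv e (S, T)) (e (Sum.inr b)) =
      indicatorExponent T b := fun b => by
    simp only [indicatorExponent, inr_mem_finsetProdEquiv]
  constructor
  · rintro ⟨⟨u, hu, hu'⟩, ⟨v, hv, hv'⟩⟩
    refine ⟨fun c => Sum.elim u v (e.symm c), (h _).2 (by simpa using ⟨hu, hv⟩), fun c => ?_⟩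
    obtain ⟨a | b, rfl⟩ := e.surjective c
    · rw [h1]
      simpa using hu' a
    · rw [h2]
      simpa using hv' b
  · rintro ⟨u, hu, hle⟩
    refine ⟨⟨_, ((h u).1 hu).1, fun a => ?_⟩, ⟨_, ((h u).1 hu).2, fun b => ?_⟩⟩
    · rw [← h1]
      exact hle _
    · rw [← h2]
      exact hle _

variable [Fintype σ] [Fintype τ] [Fintype ρ]

/-- The faces in degree `γ` are the pairs of faces in the two restrictions of `γ`, so the face
complex is a tensor product, signs included. -/
theorem IsExponentProd.hasHomology_iff {e : σ ⊕ τ ≃ ρ} (he : IsLexSum e) {s : Set (σ → ℕ)}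
    {t : Set (τ → ℕ)} {w : Set (ρ → ℕ)} (h : IsExponentProd e s t w) (γ : ρ → ℕ) (n : ℕ) :
    HasHomology (faceMatrix K w γ) faceDegree n ↔ ∃ i j, i + j = n ∧
      HasHomology (faceMatrix K s fun a => γ (e (Sum.inl a))) faceDegree i ∧
      HasHomology (faceMatrix K t fun b => γ (e (Sum.inr b))) faceDegree j := by
  refine hasHomology_prod_iff (isDifferential_faceMatrix _ _) (isDifferential_faceMatrix _ _)
    (Equiv.subtypeProdEquivProd.symm.trans
      ((finsetProdEquiv e).subtypeEquiv (h.isFace_iff γ))) ?_ ?_ n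
  · rintro ⟨S, hS⟩ ⟨T, hT⟩
    exact card_finsetProdEquiv e S T
  · rintro ⟨S, hS⟩ ⟨T, hT⟩ ⟨S', hS'⟩ ⟨T', hT'⟩
    change ∑ c : ρ, (if c ∉ finsetProdEquiv e (S, T) ∧ insert c (finsetProdEquiv e (S, T)) =
      finsetProdEquiv e (S', T') then koszulSign K c (finsetProdEquiv e (S, T)) else 0) = _
    rw [← e.sum_comp, Fintype.sum_sum_type]
    simp only [inl_mem_finsetProdEquiv, inr_mem_finsetProdEquiv, insert_inl_finsetProdEquiv,
      insert_inr_finsetProdEquiv, (finsetProdEquiv e).injective.eq_iff, Prod.mk.injEq,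
      he.koszulSign_inl, he.koszulSign_inr, Subtype.mk.injEq, faceMatrix, of_apply, faceDegree]
    congr 1
    · split_ifs with hTT
      · simp [hTT]
      · simp [hTT]
    · split_ifs with hSS
      · simp [hSS, Finset.mul_sum]
      · simp [hSS]

end Product

/-! ### Additivity of projective dimension and regularity -/

section ProductBetti

theorem exists_isLexSum {σ τ ρ : Type*} [LinearOrder σ] [LinearOrder τ] (e : σ ⊕ τ ≃ ρ) :
    ∃ _ : LinearOrder ρ, IsLexSum e := by
  let _ : LinearOrder ρ := LinearOrder.lift' (fun c => toLex (e.symm c)) fun c d h =>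
    e.symm.injective (by simpa using h)
  have key : ∀ x y : σ ⊕ τ, e x < e y ↔ toLex x < toLex y := by
    intro x y
    change toLex (e.symm (e x)) < toLex (e.symm (e y)) ↔ _
    rw [e.symm_apply_apply, e.symm_apply_apply]
  exact ⟨inferInstance, fun a a' => (key _ _).trans Sum.Lex.inl_lt_inl_iff,
    fun a a' => (key _ _).trans Sum.Lex.inr_lt_inr_iff,
    fun a b => (key _ _).2 (Sum.Lex.inl_lt_inr a b)⟩

variable {σ τ ρ K : Type*} [Fintype σ] [Fintype τ] [Fintype ρ] [Field K]

/-- The Künneth formula for the product of two monomial ideals in disjoint sets of variables. -/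
theorem IsExponentProd.gradedBetti_ne_zero_iff {e : σ ⊕ τ ≃ ρ} {s : Set (σ → ℕ)}
    {t : Set (τ → ℕ)} {w : Set (ρ → ℕ)} (h : IsExponentProd e s t w) (n m : ℕ) :
    gradedBetti (monomialIdeal K w) n m ≠ 0 ↔ ∃ i j k l, i + j = n ∧ k + l = m ∧
      gradedBetti (monomialIdeal K s) i k ≠ 0 ∧ gradedBetti (monomialIdeal K t) j l ≠ 0 := by
  obtain ⟨_⟩ := exists_linearOrder σ
  obtain ⟨_⟩ := exists_linearOrder τ
  -- Betti numbers do not involve an order on the variables, so the lexicographic one may be chosen.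
  obtain ⟨_, he⟩ := exists_isLexSum e
  simp only [gradedBetti_monomialIdeal_ne_zero_iff, h.hasHomology_iff he]
  constructor
  · rintro ⟨γ, hγ, i, j, hij, hi, hj⟩
    refine ⟨i, j, _, _, hij, ?_, ⟨_, rfl, hi⟩, ⟨_, rfl, hj⟩⟩
    rw [← hγ, ← e.sum_comp, Fintype.sum_sum_type]
  · rintro ⟨i, j, k, l, hij, hkl, ⟨α, hα, hi⟩, ⟨β, hβ, hj⟩⟩
    obtain ⟨γ, rfl, rfl⟩ : ∃ γ : ρ → ℕ, (fun a => γ (e (Sum.inl a))) = α ∧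
        (fun b => γ (e (Sum.inr b))) = β :=
      ⟨fun c => Sum.elim α β (e.symm c), by ext; simp, by ext; simp⟩
    refine ⟨γ, ?_, i, j, hij, hi, hj⟩
    rw [← e.sum_comp, Fintype.sum_sum_type, hα, hβ, hkl]

variable {s : Set (σ → ℕ)} {t : Set (τ → ℕ)} {w : Set (ρ → ℕ)} {e : σ ⊕ τ ≃ ρ}

theorem IsExponentProd.isProjDim (h : IsExponentProd e s t w) {p q : ℕ}
    (hp : IsProjDim (monomialIdeal K s) p) (hq : IsProjDim (monomialIdeal K t) q) :
    IsProjDim (monomialIdeal K w) (p + q) := by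
  obtain ⟨⟨k, hk⟩, hp⟩ := hp
  obtain ⟨⟨l, hl⟩, hq⟩ := hq
  refine ⟨⟨k + l, (h.gradedBetti_ne_zero_iff _ _).2 ⟨p, q, k, l, rfl, rfl, hk, hl⟩⟩, ?_⟩
  rintro n ⟨m, hm⟩
  obtain ⟨i, j, k, l, rfl, -, h1, h2⟩ := (h.gradedBetti_ne_zero_iff _ _).1 hm
  exact Nat.add_le_add (hp ⟨k, h1⟩) (hq ⟨l, h2⟩)

theorem IsExponentProd.isRegularity (h : IsExponentProd e s t w) {p q : ℕ}
    (hp : IsRegularity (monomialIdeal K s) p) (hq : IsRegularity (monomialIdeal K t) q) :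
    IsRegularity (monomialIdeal K w) (p + q) := by
  obtain ⟨⟨i, hi⟩, hp⟩ := hp
  obtain ⟨⟨j, hj⟩, hq⟩ := hq
  refine ⟨⟨i + j, (h.gradedBetti_ne_zero_iff _ _).2 ⟨i, j, _, _, rfl, by ring, hi, hj⟩⟩, ?_⟩
  rintro m ⟨n, hm⟩
  obtain ⟨i, j, k, l, rfl, hkl, h1, h2⟩ := (h.gradedBetti_ne_zero_iff _ _).1 hm
  -- Since `i ≤ k` and `j ≤ l`, both internal degrees can be written as homological degree plus a
  -- natural number, to which `hp` and `hq` apply.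
  obtain ⟨k, rfl⟩ := Nat.exists_eq_add_of_le (le_of_gradedBetti_ne_zero h1).1
  obtain ⟨l, rfl⟩ := Nat.exists_eq_add_of_le (le_of_gradedBetti_ne_zero h2).1
  have := hp ⟨i, h1⟩
  have := hq ⟨j, h2⟩
  omega

theorem exists_isProjDim (hs : s.Nonempty) : ∃ p, IsProjDim (monomialIdeal K s) p :=
  BddAbove.exists_isGreatest_of_nonempty
    ⟨Fintype.card σ, fun _ ⟨_, h⟩ => (le_of_gradedBetti_ne_zero h).2⟩
    ⟨0, exists_gradedBetti_ne_zero hs⟩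

theorem exists_isRegularity (hs : s.Nonempty) (hsq : ∀ u ∈ s, ∀ a, u a ≤ 1) :
    ∃ q, IsRegularity (monomialIdeal K s) q := by
  refine BddAbove.exists_isGreatest_of_nonempty
    ⟨Fintype.card σ, fun j ⟨i, h⟩ => ?_⟩ ?_
  · exact (Nat.le_add_left j i).trans (le_card_of_gradedBetti_ne_zero hsq h)
  · obtain ⟨j, hj⟩ := exists_gradedBetti_ne_zero (K := K) hs
    exact ⟨j, 0, by rwa [zero_add]⟩

end ProductBetti

/-! ### Gluing cuts along at most one vertex -/

section CutExponents

variable {V : Type*}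

open Classical in
/-- The exponent vector of the cut monomial of `A`. -/
noncomputable def cutExponent (G : Graph V) (A : Set V) : CutVar G → ℕ :=
  Sum.elim (fun e => if IsCutBy G A e then 1 else 0) fun e => if IsCutBy G A e then 0 else 1

/-- The exponent vectors of the cut monomials. -/
def cutExponents (G : Graph V) : Set (CutVar G → ℕ) :=
  {u | ∃ A : Set V, A ⊆ G.verts ∧ u = cutExponent G A}

theorem cutExponents_nonempty (G : Graph V) : (cutExponents G).Nonempty :=
  ⟨_, ∅, Set.empty_subset _, rfl⟩

theorem le_one_of_mem_cutExponents (G : Graph V) :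
    ∀ u ∈ cutExponents G, ∀ x, u x ≤ 1 := by
  rintro _ ⟨A, -, rfl⟩ (e | e) <;> by_cases h : IsCutBy G A e <;> simp [cutExponent, h]

theorem mem_verts_of_mem_edge {G : Graph V} {e : Sym2 V} (he : e ∈ G.edgeSet) {v : V}
    (hv : v ∈ e) : v ∈ G.verts :=
  G.mem_verts_of_mem_edge he hv

/-- Whether `e` is cut depends only on its two ends, which lie in both graphs. -/
theorem isCutBy_congr {G H : Graph V} {A B : Set V} {e : Sym2 V} (hG : e ∈ G.edgeSet)
    (hH : e ∈ H.edgeSet) (h : ∀ v ∈ G.verts, v ∈ H.verts → (v ∈ A ↔ v ∈ B)) :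
    IsCutBy G A e ↔ IsCutBy H B e := by
  have hv : ∀ v ∈ e, (v ∈ A ↔ v ∈ B) := fun v hv =>
    h v (mem_verts_of_mem_edge hG hv) (mem_verts_of_mem_edge hH hv)
  refine and_congr (exists_congr fun v => and_congr_right fun hve => hv v hve)
    (exists_congr fun v => and_congr_right fun hve => ?_)
  simp [mem_verts_of_mem_edge hG hve, mem_verts_of_mem_edge hH hve, hv v hve]

theorem isCutBy_diff_iff {G : Graph V} {A : Set V} {e : Sym2 V} (he : e ∈ G.edgeSet) :
    IsCutBy G (G.verts \ A) e ↔ IsCutBy G A e := by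
  rw [IsCutBy, IsCutBy, and_comm]
  refine and_congr (exists_congr fun v => and_congr_right fun hve => ?_) Iff.rfl
  simp [mem_verts_of_mem_edge he hve]

theorem disjoint_edgeSet {G H : Graph V} (h : (G.verts ∩ H.verts).Subsingleton) :
    Disjoint G.edgeSet H.edgeSet := by
  rw [Set.disjoint_left]
  intro e hG hH
  induction e with | _ x y
  refine (G.adj_sub hG).ne (h ⟨?_, ?_⟩ ⟨?_, ?_⟩)
  · exact G.edge_vert hG
  · exact H.edge_vert hH
  · exact G.edge_vert (G.adj_symm hG)
  · exact H.edge_vert (H.adj_symm hH)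

/-- The edges of the union of two graphs without common edges. -/
noncomputable def edgeSumEquiv {G H : Graph V} (h : Disjoint G.edgeSet H.edgeSet) :
    G.edgeSet ⊕ H.edgeSet ≃ (G ⊔ H).edgeSet :=
  Equiv.ofBijective (Sum.elim (fun e => ⟨e.1, by simp [e.2]⟩) fun e => ⟨e.1, by simp [e.2]⟩) (by
    constructor
    · rintro (⟨x, hx⟩ | ⟨x, hx⟩) (⟨y, hy⟩ | ⟨y, hy⟩) hxy
      all_goals
        simp only [Sum.elim_inl, Sum.elim_inr, Subtype.mk.injEq] at hxy
        subst hxy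
      · rfl
      · exact (Set.disjoint_left.1 h hx hy).elim
      · exact (Set.disjoint_left.1 h hy hx).elim
      · rfl
    · rintro ⟨x, hx⟩
      rcases (by simpa using hx : x ∈ G.edgeSet ∨ x ∈ H.edgeSet) with hx | hx
      · exact ⟨Sum.inl ⟨x, hx⟩, rfl⟩
      · exact ⟨Sum.inr ⟨x, hx⟩, rfl⟩)

/-- The variables of the union of two graphs without common edges. -/
noncomputable def cutVarSumEquiv {G H : Graph V} (h : Disjoint G.edgeSet H.edgeSet) :
    CutVar G ⊕ CutVar H ≃ CutVar (G ⊔ H) :=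
  (Equiv.sumSumSumComm _ _ _ _).trans (Equiv.sumCongr (edgeSumEquiv h) (edgeSumEquiv h))

theorem cutExponent_inl {G H : Graph V} (h : Disjoint G.edgeSet H.edgeSet) {A C : Set V}
    (hAC : ∀ v ∈ G.verts, v ∈ A ↔ v ∈ C) (x : CutVar G) :
    cutExponent (G ⊔ H) C (cutVarSumEquiv h (Sum.inl x)) = cutExponent G A x := by
  have key : ∀ e : G.edgeSet, IsCutBy (G ⊔ H) C e ↔ IsCutBy G A e := fun e =>
    isCutBy_congr (by simp [e.2]) e.2 fun v _ hv => (hAC v hv).symm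
  classical
  rcases x with e | e
  · exact if_congr (key e) rfl rfl
  · exact if_congr (key e) rfl rfl

theorem cutExponent_inr {G H : Graph V} (h : Disjoint G.edgeSet H.edgeSet) {B C : Set V}
    (hBC : ∀ v ∈ H.verts, v ∈ B ↔ v ∈ C) (x : CutVar H) :
    cutExponent (G ⊔ H) C (cutVarSumEquiv h (Sum.inr x)) = cutExponent H B x := by
  have key : ∀ e : H.edgeSet, IsCutBy (G ⊔ H) C e ↔ IsCutBy H B e := fun e =>
    isCutBy_congr (by simp [e.2]) e.2 fun v _ hv => (hBC v hv).symm
  classical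
  rcases x with e | e
  · exact if_congr (key e) rfl rfl
  · exact if_congr (key e) rfl rfl

theorem cutExponent_diff (G : Graph V) (A : Set V) :
    cutExponent G (G.verts \ A) = cutExponent G A := by
  ext x
  classical
  rcases x with e | e
  · exact if_congr (isCutBy_diff_iff e.2) rfl rfl
  · exact if_congr (isCutBy_diff_iff e.2) rfl rfl

/-- A cut of `H` can be replaced by its complement, so that it agrees with a given set in the
common vertex of `G` and `H`. -/
theorem exists_cutExponent_eq {G H : Graph V} (h : (G.verts ∩ H.verts).Subsingleton) (A : Set V)
    {B : Set V} (hB : B ⊆ H.verts) :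
    ∃ B' ⊆ H.verts, cutExponent H B' = cutExponent H B ∧
      ∀ v ∈ G.verts, v ∈ H.verts → (v ∈ A ↔ v ∈ B') := by
  by_cases hagree : ∀ v ∈ G.verts, v ∈ H.verts → (v ∈ A ↔ v ∈ B)
  · exact ⟨B, hB, rfl, hagree⟩
  · push Not at hagree
    obtain ⟨w, hwG, hwH, hw⟩ := hagree
    refine ⟨H.verts \ B, Set.sdiff_subset, cutExponent_diff H B, fun v hvG hvH => ?_⟩
    -- The disagreement is at the only common vertex, where the complement reverses membership.
    obtain rfl : v = w := h ⟨hvG, hvH⟩ ⟨hwG, hwH⟩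
    simp only [Set.mem_sdiff, hvH, true_and]
    tauto

/-- A cut of the union restricts to both graphs. Conversely, once two cuts agree on the common
vertices, their union restricts to each of them. -/
theorem isExponentProd_cutExponents {G H : Graph V} (h : (G.verts ∩ H.verts).Subsingleton) :
    IsExponentProd (cutVarSumEquiv (disjoint_edgeSet h)) (cutExponents G) (cutExponents H)
      (cutExponents (G ⊔ H)) := by
  intro u
  constructor
  · rintro ⟨C, -, rfl⟩
    exact ⟨⟨C ∩ G.verts, Set.inter_subset_right,
        funext fun x => cutExponent_inl _ (fun v hv => by simp [hv]) x⟩,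
      ⟨C ∩ H.verts, Set.inter_subset_right,
        funext fun x => cutExponent_inr _ (fun v hv => by simp [hv]) x⟩⟩
  · rintro ⟨⟨A, hA, huA⟩, ⟨B, hB, huB⟩⟩
    obtain ⟨B', hB', hBB', hAB⟩ := exists_cutExponent_eq h A hB
    refine ⟨A ∪ B', Set.union_subset_union hA hB', funext fun x => ?_⟩
    obtain ⟨x | x, rfl⟩ := (cutVarSumEquiv (disjoint_edgeSet h)).surjective x
    · rw [cutExponent_inl _ (A := A)]
      · exact congrFun huA x
      · intro v hv
        refine ⟨Or.inl, ?_⟩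
        rintro (hvA | hvB)
        · exact hvA
        · exact (hAB v hv (hB' hvB)).2 hvB
    · rw [cutExponent_inr _ (B := B'), hBB']
      · exact congrFun huB x
      · intro v hv
        refine ⟨Or.inr, ?_⟩
        rintro (hvA | hvB)
        · exact (hAB v (hA hvA) hv).1 hvA
        · exact hvB

theorem iSup_fin_succ {L : Type*} [CompleteLattice L] {r : ℕ} (f : Fin (r + 1) → L) :
    ⨆ k, f k = (⨆ k : Fin r, f k.castSucc) ⊔ f (Fin.last r) := by
  refine le_antisymm (iSup_le fun k => ?_) (sup_le (iSup_le fun k => le_iSup f _) (le_iSup f _))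
  induction k using Fin.lastCases with
  | last => exact le_sup_right
  | cast k => exact le_sup_of_le_left (le_iSup (fun k : Fin r => f k.castSucc) k)

variable [Finite V]

theorem cutMonomial_eq_monomial (K : Type*) [Field K] (G : Graph V) (A : Set V) :
    cutMonomial K G A = monomial (Finsupp.equivFunOnFinite.symm (cutExponent G A)) 1 := by
  classical
  have h1 : cutMonomial K G A = ∏ e : G.edgeSet,
      monomial (Finsupp.single (if IsCutBy G A e then Sum.inl e else Sum.inr e : CutVar G) 1)
        (1 : K) :=
    Finset.prod_congr rfl fun e _ => by split_ifs <;> rfl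
  rw [h1, ← monomial_sum_one]
  refine congrArg (fun m => monomial m (1 : K)) (Finsupp.ext fun x => ?_)
  rw [Finsupp.finsetSum_apply]
  rcases x with x | x
  · rw [Finset.sum_eq_single x]
    · by_cases h : IsCutBy G A x <;> simp [cutExponent, h]
    · intro e _ he
      by_cases h : IsCutBy G A e <;> simp [h, he]
    · simp
  · rw [Finset.sum_eq_single x]
    · by_cases h : IsCutBy G A x <;> simp [cutExponent, h]
    · intro e _ he
      by_cases h : IsCutBy G A e <;> simp [h, he]
    · simp

theorem cutIdeal_eq_monomialIdeal (K : Type*) [Field K] (G : Graph V) :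
    cutIdeal K G = monomialIdeal K (cutExponents G) := by
  rw [cutIdeal, monomialIdeal]
  congr 1
  ext f
  constructor
  · rintro ⟨A, hA, rfl⟩
    exact ⟨_, ⟨A, hA, rfl⟩, (cutMonomial_eq_monomial K G A).symm⟩
  · rintro ⟨m, ⟨A, hA, hm⟩, rfl⟩
    refine ⟨A, hA, ?_⟩
    rw [cutMonomial_eq_monomial, ← hm]
    congr 1
    ext
    rfl

/-- Induction attaches the last graph to the union of the earlier ones, which it meets in at most
one vertex. -/
theorem isProjDim_isRegularity_iSup (K : Type*) [Field K] {r : ℕ} (G : Fin r → Graph V)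
    (hmeet : ∀ i : Fin r, ((⋃ j : Fin r, ⋃ _ : j < i, (G j).verts) ∩ (G i).verts).encard ≤ 1)
    (p q : Fin r → ℕ) (hp : ∀ k, IsProjDim (cutIdeal K (G k)) (p k))
    (hq : ∀ k, IsRegularity (cutIdeal K (G k)) (q k)) :
    IsProjDim (cutIdeal K (⨆ k, G k)) (∑ k, p k) ∧
      IsRegularity (cutIdeal K (⨆ k, G k)) (∑ k, q k) := by
  induction r with
  -- The empty union has no edges, hence no variables, and the bounds by the number of variables
  -- force both invariants to be `0`.
  | zero =>
    have hverts : (⨆ k, G k).verts = ∅ := by simp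
    have hcard : Fintype.card (CutVar (⨆ k, G k)) = 0 := by
      rw [Fintype.card_eq_zero_iff]
      have : IsEmpty (⨆ k, G k).edgeSet := ⟨fun e => by
        obtain ⟨e, he⟩ := e
        induction e with | _ x y
        have := (⨆ k, G k).edge_vert he
        rw [hverts] at this
        exact this⟩
      infer_instance
    rw [cutIdeal_eq_monomialIdeal]
    obtain ⟨p', hp'⟩ := exists_isProjDim (K := K) (cutExponents_nonempty (⨆ k, G k))
    obtain ⟨q', hq'⟩ := exists_isRegularity (K := K) (cutExponents_nonempty (⨆ k, G k))
      (le_one_of_mem_cutExponents _)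
    obtain ⟨k, hk⟩ := hp'.1
    obtain ⟨l, hl⟩ := hq'.1
    have h1 := (le_of_gradedBetti_ne_zero hk).2
    have h2 := le_card_of_gradedBetti_ne_zero (le_one_of_mem_cutExponents _) hl
    obtain rfl : p' = 0 := by omega
    obtain rfl : q' = 0 := by omega
    simpa using ⟨hp', hq'⟩
  | succ r ih =>
    obtain ⟨h1, h2⟩ := ih (fun k => G k.castSucc) (fun i => by
      refine le_trans (Set.encard_le_encard (Set.inter_subset_inter_left _ ?_)) (hmeet i.castSucc)
      refine Set.iUnion₂_subset fun j hj => ?_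
      exact Set.subset_iUnion₂_of_subset j.castSucc (Fin.castSucc_lt_castSucc_iff.2 hj) subset_rfl)
      _ _ (fun k => hp k.castSucc) (fun k => hq k.castSucc)
    have hsub : ((⨆ k : Fin r, G k.castSucc).verts ∩ (G (Fin.last r)).verts).Subsingleton := by
      rw [← Set.encard_le_one_iff_subsingleton]
      refine le_trans (Set.encard_le_encard (Set.inter_subset_inter_left _ ?_)) (hmeet (Fin.last r))
      rw [SimpleGraph.Subgraph.verts_iSup]
      refine Set.iUnion_subset fun j => ?_
      exact Set.subset_iUnion₂_of_subset j.castSucc (Fin.castSucc_lt_last j) subset_rfl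
    have hprod := isExponentProd_cutExponents hsub
    have h3 := hp (Fin.last r)
    have h4 := hq (Fin.last r)
    rw [iSup_fin_succ, Fin.sum_univ_castSucc, Fin.sum_univ_castSucc]
    rw [cutIdeal_eq_monomialIdeal] at h1 h2 h3 h4 ⊢
    exact ⟨hprod.isProjDim h1 h3, hprod.isRegularity h2 h4⟩

end CutExponents

end CutIdeals

theorem corollary4p1 {V : Type*} [Finite V] (K : Type*) [Field K] (r : ℕ)
    (G : Fin r → CutIdeals.Graph V)
    (hedge : ∀ k, (G k).edgeSet.Nonempty)
    (hmeet : ∀ i : Fin r, ((⋃ j : Fin r, ⋃ _ : j < i, (G j).verts) ∩ (G i).verts).encard ≤ 1) :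
    ∃ p q : Fin r → ℕ,
      (∀ k, CutIdeals.IsProjDim (CutIdeals.cutIdeal K (G k)) (p k) ∧
        CutIdeals.IsRegularity (CutIdeals.cutIdeal K (G k)) (q k)) ∧
      CutIdeals.IsProjDim (CutIdeals.cutIdeal K (⨆ k, G k)) (∑ k, p k) ∧
      CutIdeals.IsRegularity (CutIdeals.cutIdeal K (⨆ k, G k)) (∑ k, q k) := by
  have hex : ∀ k, ∃ p q, CutIdeals.IsProjDim (CutIdeals.cutIdeal K (G k)) p ∧
      CutIdeals.IsRegularity (CutIdeals.cutIdeal K (G k)) q := by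
    intro k
    rw [CutIdeals.cutIdeal_eq_monomialIdeal]
    obtain ⟨p, hp⟩ := CutIdeals.exists_isProjDim (K := K) (CutIdeals.cutExponents_nonempty (G k))
    obtain ⟨q, hq⟩ := CutIdeals.exists_isRegularity (K := K)
      (CutIdeals.cutExponents_nonempty (G k)) (CutIdeals.le_one_of_mem_cutExponents _)
    exact ⟨p, q, hp, hq⟩
  choose p q h using hex
  exact ⟨p, q, h, CutIdeals.isProjDim_isRegularity_iSup K G hmeet p q (fun k => (h k).1)
    fun k => (h k).2⟩
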